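/- **Setting.** A game graph with live edges $\mathcal G^\ell$ consists of a finite non-empty vertex set $V$ partitioned into player 0 vertices $V_0$ and player 1 vertices $V_1$, an edge relation $E\subseteq V\times V$ in which every vertex has at least one successor, and a set of live edges $E^\ell\subseteq E\cap(V_1\times V)$. A strategy of player $i$ maps each $w\cdot v$ with $w\in V^*$, $v\in V_i$ to a successor of $v$. A play $\pi$ is fair if for every $(v,v')\in E^\ell$: if $\pi$ visits $v$ infinitely often, then it takes the edge $(v,v')$ infinitely often. In the fair adversarial game for a winning condition $\varphi\subseteq V^\omega$, a player 0 strategy wins from $v$ if every play from $v$ that is compliant with it and with some player 1 strategy lies in $\varphi$ whenever it is fair; the winning region is the set of vertices from which player 0 has a winning strategy. A player 0 strategy has finite memory if it is computed by a finite-state machine reading the history. A generalized Rabin condition with index set $P=\{1,\dots,k\}$, $k\ge 0$, consists of pairs $(\{{}^1G_j,\dots,{}^{m_j}G_j\},R_j)$, $j\in P$, with $m_j\ge 1$ and ${}^lG_j,R_j\subseteq V$; a play satisfies it if for some $j$ it visits $R_j$ only finitely often and visits each ${}^lG_j$, $1\le l\le m_j$, infinitely often. For $S,T\subseteq V$ let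 $$\mathrm{Cpre}(S)=\{v\in V_0: E(v)\cap S\ne\emptyset\}\cup\{v\in V_1: E(v)\subseteq S\},$$ $$\mathrm{Apre}(S,T)=\mathrm{Cpre}(T)\cup\{v\in V_1: E^\ell(v)\cap T\neq\emptyset,\ E(v)\subseteq S\},$$ and let $$Z^*=\nu Y_{p_0}.\,\mu X_{p_0}.\bigcup_{p_1\in P}\nu Y_{p_1}.\bigcap_{l_1=1}^{m_{p_1}}\mu\,{}^{l_1}X_{p_1}.\ \cdots\bigcup_{p_k\in P\setminus\{p_1,\dots,p_{k-1}\}}\nu Y_{p_k}.\bigcap_{l_k=1}^{m_{p_k}}\mu\,{}^{l_k}X_{p_k}.\ \bigcup_{j=0}^{k}{}^{l_j}\mathcal C_{p_j},$$ $${}^{l_j}\mathcal C_{p_j}=\Big(\bigcap_{i=0}^{j}\overline{R_{p_i}}\Big)\cap\Big[\big({}^{l_j}G_{p_j}\cap\mathrm{Cpre}(Y_{p_j})\big)\cup\mathrm{Apre}(Y_{p_j},{}^{l_j}X_{p_j})\Big],$$ where $p_0=0$ is an artificial pair with the single goal set $\emptyset$ (so $m_0=l_0=1$) and $R_0=\emptyset$.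 The *fixpoint algorithm* evaluates this expression from the outside in by iteration. Each evaluation of a $\mu$-variable starts from $\emptyset$. The evaluations of a $\nu$-variable are grouped by the pairs, goal indices and $\mu$-counters of the enclosing levels (and the current pair): the first evaluation in a group starts from $V$, each later one starts from the result of the previous one in the group, and that result is reused without iterating if the union of the sets $\mathcal C$ of the enclosing levels is the same as then. Every iteration stops when a round changes nothing, and in any case after $|V|$ rounds. A *symbolic step* is one union, intersection, complement, $\mathrm{Cpre}$, $\mathrm{Apre}$ or equality test of vertex sets. **Theorem.** There is an absolute constant $C$ such that for every such $\mathcal G^\ell$ with $n=|V|$ and every such generalized Rabin condition: 1. $Z^*$ is the winning region of player 0 in the fair adversarial game for the generalized Rabin condition. 2. The fixpoint algorithm returns $Z^*$ after at most $C\,n^{k+2}\,k!\,m_1\cdots m_k$ symbolic steps. 3. There is a finite-memory player 0 strategy that wins this game from every vertex of $Z^*$. Moreover, for non-empty $F_1,\dots,F_k\subseteq V$, the Muller condition "the set of vertices visited infinitely often is one of the $F_i$" is satisfied by the same plays as the generalized Rabin condition with goal sets $\{v\}$, $v\in F_i$, and $R_i=V\setminus F_i$; hence the set $Z^*$ of the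 latter is the winning region of player 0 in the fair adversarial Muller game, the fixpoint algorithm computes it in at most $C\,n^{k+2}\,k!\,|F_1|\cdots|F_k|$ symbolic steps, and player 0 has a finite-memory strategy that wins the Muller game from every vertex of $Z^*$. -/

import Mathlib

open Filter

namespace FairGame

/-! ### Games with live edges -/

/-- A two-player game graph with live edges. Player 0 owns `V0`, player 1 owns the complement of
`V0`; `E` is the edge relation and the live edges `El` are edges that leave player 1 vertices. -/
structure LiveGame (V : Type*) where
  V0 : Set V
  E : V → V → Prop
  El : V → V → Prop
  live_edge : ∀ v w, El v w → v ∉ V0 ∧ E v w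

/-- A strategy for the owner of the vertices in `A`: the history strictly before the current vertex
and the current vertex (which lies in `A`) determine a successor of the current vertex. -/
structure Strategy {V : Type*} (𝒢 : LiveGame V) (A : Set V) where
  move : List V → A → V
  legal : ∀ (w : List V) (v : A), 𝒢.E v (move w v)

/-- The word `π 0 … π (i - 1)`. -/
def history {V : Type*} (π : ℕ → V) (i : ℕ) : List V := (List.range i).map π

/-- In `π`, the vertices of `A` are left as `ρ` prescribes. -/
def Follows {V : Type*} {𝒢 : LiveGame V} {A : Set V} (ρ : Strategy 𝒢 A) (π : ℕ → V) : Prop :=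
  ∀ (i : ℕ) (h : π i ∈ A), π (i + 1) = ρ.move (history π i) ⟨π i, h⟩

/-- The player 0 strategy `ρ₀` wins from `v` for the winning condition `φ`: against every player 1
strategy `ρ₁`, the play from `v` compliant with `ρ₀` and `ρ₁` satisfies `φ`. -/
def WinsFrom {V : Type*} {𝒢 : LiveGame V} (ρ₀ : Strategy 𝒢 𝒢.V0) (φ : Set (ℕ → V)) (v : V) :
    Prop :=
  ∀ (ρ₁ : Strategy 𝒢 𝒢.V0ᶜ) (π : ℕ → V), π 0 = v → Follows ρ₀ π → Follows ρ₁ π → π ∈ φ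

/-- The winning region of player 0 for `φ`. -/
def winningRegion {V : Type*} (𝒢 : LiveGame V) (φ : Set (ℕ → V)) : Set V :=
  {v | ∃ ρ₀ : Strategy 𝒢 𝒢.V0, WinsFrom ρ₀ φ v}

/-- Strong transition fairness: every live edge whose source is visited infinitely often is taken
infinitely often. -/
def fairPlays {V : Type*} (𝒢 : LiveGame V) : Set (ℕ → V) :=
  {π | ∀ v w, 𝒢.El v w → (∃ᶠ i in atTop, π i = v) → ∃ᶠ i in atTop, π i = v ∧ π (i + 1) = w}

/-- The winning condition "fair implies `φ`" of the fair adversarial game for `φ`. -/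
def fairAdversarial {V : Type*} (𝒢 : LiveGame V) (φ : Set (ℕ → V)) : Set (ℕ → V) :=
  {π | π ∈ fairPlays 𝒢 → π ∈ φ}

/-- A player 0 strategy has finite memory if it is computed by a finite-state machine that reads the
history; `out` chooses the successor from the memory state and the current vertex. -/
def FiniteMemory {V : Type*} {𝒢 : LiveGame V} (ρ : Strategy 𝒢 𝒢.V0) : Prop :=
  ∃ (M : Type) (_ : Finite M) (init : M) (upd : M → V → M) (out : M → 𝒢.V0 → V),
    ∀ (w : List V) (v : 𝒢.V0), ρ.move w v = out (w.foldl upd init) v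

/-! ### Winning conditions -/

/-- A generalized Rabin condition with `k` pairs: pair `j` has the goal sets `G j l` for
`l = 0, …, m j - 1`, and the set `R j` to be avoided from some point on. -/
structure GenRabin (V : Type*) (k : ℕ) where
  m : Fin k → ℕ
  G : (j : Fin k) → Fin (m j) → Set V
  R : Fin k → Set V

/-- The plays that satisfy a generalized Rabin condition. -/
def GenRabin.plays {V : Type*} {k : ℕ} (𝓡 : GenRabin V k) : Set (ℕ → V) :=
  {π | ∃ j : Fin k, (∀ᶠ i in atTop, π i ∉ 𝓡.R j) ∧
    ∀ l : Fin (𝓡.m j), ∃ᶠ i in atTop, π i ∈ 𝓡.G j l}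

/-- The plays that satisfy the Muller condition `{F 1, …, F k}`: the set of vertices visited
infinitely often is one of the `F i`. -/
def mullerPlays {V : Type*} {k : ℕ} (F : Fin k → Finset V) : Set (ℕ → V) :=
  {π | ∃ j : Fin k, {v | ∃ᶠ i in atTop, π i = v} = (F j : Set V)}

/-- The generalized Rabin condition of a Muller condition: pair `j` has the singletons of the
elements of `F j` as goal sets, and the complement of `F j` as set to be avoided. -/
noncomputable def GenRabin.ofMuller {V : Type*} {k : ℕ} (F : Fin k → Finset V) : GenRabin V k where
  m j := (F j).card
  G j l := {((F j).equivFin.symm l : V)}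
  R j := (F j : Set V)ᶜ

/-! ### Set transformers and the fixpoint -/

def preExists0 {V : Type*} (𝒢 : LiveGame V) (S : Set V) : Set V :=
  {v | v ∈ 𝒢.V0 ∧ ∃ w, 𝒢.E v w ∧ w ∈ S}

def preForall1 {V : Type*} (𝒢 : LiveGame V) (S : Set V) : Set V :=
  {v | v ∉ 𝒢.V0 ∧ ∀ w, 𝒢.E v w → w ∈ S}

def cpre {V : Type*} (𝒢 : LiveGame V) (S : Set V) : Set V := preExists0 𝒢 S ∪ preForall1 𝒢 S

def lpre {V : Type*} (𝒢 : LiveGame V) (S : Set V) : Set V := {v | ∃ w, 𝒢.El v w ∧ w ∈ S}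

def apre {V : Type*} (𝒢 : LiveGame V) (S T : Set V) : Set V :=
  cpre 𝒢 T ∪ (lpre 𝒢 T ∩ preForall1 𝒢 S)

/-- Least fixed point of a monotone set transformer. -/
def mu {V : Type*} (f : Set V → Set V) : Set V := sInf {X | f X ⊆ X}

/-- Greatest fixed point of a monotone set transformer. -/
def nu {V : Type*} (f : Set V → Set V) : Set V := sSup {Y | Y ⊆ f Y}

theorem mu_eq_lfp {V : Type*} (f : Set V →o Set V) : mu f = OrderHom.lfp f := rfl

theorem nu_eq_gfp {V : Type*} (f : Set V →o Set V) : nu f = OrderHom.gfp f := rfl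

/-- One quantified level `j` of the fixpoint expression: the goal set with index `l_j` of the pair
`p_j`, the set `R` of that pair, and the values of the variables `Y` and `X` of that level. -/
structure Level (V : Type*) where
  goal : Set V
  bad : Set V
  Y : Set V
  X : Set V

/-- `⋃_j (⋂_{i ≤ j} (R_{p_i})ᶜ) ∩ [(G_{p_j} ∩ Cpre(Y_{p_j})) ∪ Apre(Y_{p_j}, X_{p_j})]`. -/
def matrix {V : Type*} (𝒢 : LiveGame V) (env : List (Level V)) : Set V :=
  ⋃ j : Fin env.length, (⋂ i : Fin env.length, ⋂ _ : i ≤ j, (env[i].bad)ᶜ) ∩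
    ((env[j].goal ∩ cpre 𝒢 env[j].Y) ∪ apre 𝒢 env[j].Y env[j].X)

/-- The part of the fixpoint expression below the levels `env`, with `d` levels still to come and
the set `P` of the pairs that are still available. -/
def fixpointBelow {V : Type*} {k : ℕ} (𝒢 : LiveGame V) (𝓡 : GenRabin V k) :
    ℕ → Finset (Fin k) → List (Level V) → Set V
  | 0, _, env => matrix 𝒢 env
  | d + 1, P, env => ⋃ p ∈ P, nu fun Y => ⋂ l : Fin (𝓡.m p), mu fun X =>
      fixpointBelow 𝒢 𝓡 d (P.erase p) (env ++ [⟨𝓡.G p l, 𝓡.R p, Y, X⟩])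

/-- The set `Z*`; the outermost level belongs to the artificial pair with the single goal set `∅`
and `R = ∅`. -/
def fixpoint {V : Type*} {k : ℕ} (𝒢 : LiveGame V) (𝓡 : GenRabin V k) : Set V :=
  nu fun Y => mu fun X => fixpointBelow 𝒢 𝓡 k Finset.univ [⟨∅, ∅, Y, X⟩]

/-! ### Symbolic computations

A symbolic computation handles sets of vertices only through the operations `sUnion`, `sInter`,
`sCompl`, `sCpre`, `sApre` and the equality test `sEq`. Each of them is one symbolic step. -/

/-- State of a symbolic computation: the number of symbolic steps made so far, and a table in which
computed sets are kept for reuse. -/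
structure SymState (V : Type*) where
  steps : ℕ
  table : List ℕ → Option (Set V × Set V)

abbrev Sym (V : Type*) (α : Type*) := SymState V → α × SymState V

namespace Sym

variable {V : Type*}

def ret {α : Type*} (a : α) : Sym V α := fun s => (a, s)

def bind {α β : Type*} (x : Sym V α) (f : α → Sym V β) : Sym V β := fun s =>
  f (x s).1 (x s).2

/-- Return `a` and count one symbolic step. -/
def tick {α : Type*} (a : α) : Sym V α := fun s => (a, { s with steps := s.steps + 1 })

def sUnion (A B : Set V) : Sym V (Set V) := tick (A ∪ B)
def sInter (A B : Set V) : Sym V (Set V) := tick (A ∩ B)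
def sCompl (A : Set V) : Sym V (Set V) := tick Aᶜ
def sCpre (𝒢 : LiveGame V) (A : Set V) : Sym V (Set V) := tick (cpre 𝒢 A)
def sApre (𝒢 : LiveGame V) (A B : Set V) : Sym V (Set V) := tick (apre 𝒢 A B)

open Classical in
noncomputable def sEq (A B : Set V) : Sym V Bool := tick (decide (A = B))

/-- Table lookup. -/
def fetch (key : List ℕ) : Sym V (Option (Set V × Set V)) := fun s => (s.table key, s)

/-- Table update. -/
def store (key : List ℕ) (e : Set V × Set V) : Sym V Unit := fun s =>
  ((), { s with table := Function.update s.table key (some e) })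

/-- Union of the results of a list of computations. -/
def unionAll : List (Sym V (Set V)) → Sym V (Set V)
  | [] => ret ∅
  | x :: xs => bind x fun A => bind (unionAll xs) fun B => sUnion A B

/-- Intersection of the results of a list of computations. -/
def interAll : List (Sym V (Set V)) → Sym V (Set V)
  | [] => ret Set.univ
  | x :: xs => bind x fun A => bind (interAll xs) fun B => sInter A B

/-- At most `fuel` rounds of the iteration `X ↦ f i X`, where `i` is the number of the round; stop
as soon as a round changes nothing. -/
noncomputable def iter (f : ℕ → Set V → Sym V (Set V)) : ℕ → ℕ → Set V → Sym V (Set V)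
  | 0, _, X => ret X
  | fuel + 1, i, X => bind (f i X) fun X' => bind (sEq X' X) fun b =>
      if b then ret X else iter f fuel (i + 1) X'

/-- Iteration for a `ν`-variable. The table entry at `key` consists of the input `S` (the only
information on the enclosing variables that enters) and of the result of the last evaluation under
this key. If the input is unchanged, the result is reused; otherwise the iteration starts from that
result, and from the set of all vertices if there is none. -/
noncomputable def warmNu (n : ℕ) (key : List ℕ) (S : Set V) (body : Set V → Sym V (Set V)) :
    Sym V (Set V) :=
  let run (Y₀ : Set V) : Sym V (Set V) :=
    bind (iter (fun _ Y => body Y) n 0 Y₀) fun Y => bind (store key (S, Y)) fun _ => ret Y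
  bind (fetch key) fun e => match e with
    | none => run Set.univ
    | some (T, Y₀) => bind (sEq S T) fun b => if b then ret Y₀ else run Y₀

/-- Evaluation of one level `νY. ⋂_l μX. …`. Here `Q` is the intersection of the complements of the
sets `R` of the enclosing levels, `S` the union of the sets `C` of the enclosing levels, and `next`
evaluates the levels below. The `μ`-iterations start from `∅`. Keys list the pairs, goal indices and
`μ`-counters of the enclosing levels, and the current pair. -/
noncomputable def evalLevel (𝒢 : LiveGame V) (n : ℕ)
    (next : List ℕ → Set V → Set V → Sym V (Set V))
    (key : List ℕ) (goals : List (Set V)) (bad Q S : Set V) : Sym V (Set V) :=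
  bind (sCompl bad) fun B => bind (sInter Q B) fun Q' =>
    warmNu n key S fun Y =>
      interAll (goals.mapIdx fun l G =>
        iter (fun i X =>
          bind (sCpre 𝒢 Y) fun A₁ => bind (sInter G A₁) fun A₂ =>
          bind (sApre 𝒢 Y X) fun A₃ => bind (sUnion A₂ A₃) fun A₄ =>
          bind (sInter Q' A₄) fun C => bind (sUnion S C) fun S' =>
            next (key ++ [l, i]) Q' S') n 0 ∅)

/-- Evaluation of the part of the fixpoint expression below some level, with `d` levels still to
come and the list `P` of the pairs that are still available. -/
noncomputable def evalBelow {k : ℕ} (𝒢 : LiveGame V) (𝓡 : GenRabin V k) (n : ℕ) :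
    ℕ → List (Fin k) → List ℕ → Set V → Set V → Sym V (Set V)
  | 0, _, _, _, S => ret S
  | d + 1, P, key, Q, S => unionAll (P.map fun p =>
      evalLevel 𝒢 n (evalBelow 𝒢 𝓡 n d (P.erase p)) (key ++ [(p : ℕ) + 1])
        (List.ofFn (𝓡.G p)) (𝓡.R p) Q S)

end Sym

/-- The fixpoint algorithm: accelerated iterative evaluation of the expression that defines
`fixpoint 𝒢 𝓡`, started with an empty table and the step counter at zero. It returns the computed
set and the number of symbolic steps. -/
noncomputable def fixpointAlgorithm {V : Type*} [Fintype V] {k : ℕ} (𝒢 : LiveGame V)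
    (𝓡 : GenRabin V k) : Set V × ℕ :=
  let n := Fintype.card V
  let r := Sym.evalLevel 𝒢 n (Sym.evalBelow 𝒢 𝓡 n k (List.finRange k)) [0] [∅] ∅ Set.univ ∅
    ⟨0, fun _ => none⟩
  (r.1, r.2.steps)

end FairGame

namespace FairGame

/-! ### Fixed points of monotone set transformers -/

section Lattice

variable {V : Type*} {f g : Set V → Set V}

/-! The enclosing levels enter a subexpression only through `Q`, the intersection of the complements
of their sets `R`, and `S`, the union of their sets `C`. The function `below` is the expression in
this form and is monotone in `S`. All three parts of the proof work with it.

Outside `Z*`, player 1 spoils every fixed player 0 strategy, so no determinacy theorem is needed.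
The core is `escape_or_evade`, an induction on the number of remaining pairs. Outside the value for
a pair `p`, at a given stage of its `ν`-variable, some goal set fails. By induction, player 1 can
then stay forever on a fair path that avoids this goal and violates the other pairs, or reach `R p`,
or fall to an earlier `ν`-stage, or leave the region under consideration. If no evading path or exit
arises in this way, every `R p` can be reached again and again. Live edges taken on the way do not
leave the complement of the value, so they can be served in rotation and the path becomes fair
(`evade_of_segments`).

Inside `Z*`, the memory keeps one goal index per pair. At each level, `advice` picks the least pair
and then the least `μ`-stage that support the current vertex. No move loses the support of the pair,
so the pair stabilizes. Then either its goals are visited cyclically, or its goal index stabilizes,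
and fairness makes its stage stabilize as well (`eventually_rank_const`). In the latter case only
moves of the deeper levels remain, and induction applies (`exists_satPair_of_advice`).

The step bound is an amortized analysis. Under a fixed key the inputs `S` only shrink, because the
enclosing `ν`-variables shrink and `μ`-approximants with equal counters shrink with them. Hence the
previous result is a valid start, and all rounds under one key together number at most `2n + 1`
(`runs_warmNu`). Summing over the keys gives the bound. A Muller condition is the special case with
singleton goals (`plays_ofMuller`). -/

theorem mu_subset {X : Set V} (h : f X ⊆ X) : mu f ⊆ X := sInf_le h

theorem subset_nu {Y : Set V} (h : Y ⊆ f Y) : Y ⊆ nu f := le_sSup h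

theorem map_mu (hf : Monotone f) : f (mu f) = mu f := OrderHom.map_lfp ⟨f, hf⟩

theorem map_nu (hf : Monotone f) : f (nu f) = nu f := OrderHom.map_gfp ⟨f, hf⟩

theorem mu_mono (h : ∀ X, f X ⊆ g X) : mu f ⊆ mu g :=
  sInf_le_sInf fun X hX => (h X).trans hX

theorem nu_mono (h : ∀ X, f X ⊆ g X) : nu f ⊆ nu g :=
  sSup_le_sSup fun X hX => Set.Subset.trans hX (h X)

/-- Induction along the stages at which vertices drop out of a greatest fixed point. -/
theorem notMem_nu_induction {p : V → Prop}
    (step : ∀ Y : Set V, (∀ v ∉ Y, p v) → ∀ v ∉ f Y, p v) : ∀ v ∉ nu f, p v := by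
  intro v hv
  by_contra hp
  -- Coinduction: the step hypothesis says exactly that the set where `p` fails is a post-fixed
  -- point.
  refine hv (subset_nu (f := f) (Y := {v | ¬ p v}) (fun u hu => ?_) hp)
  by_contra hfu
  exact hu (step _ (fun w hw => not_not.mp hw) u hfu)

theorem iterate_empty_mono (hf : Monotone f) : Monotone fun r => f^[r] (∅ : Set V) :=
  monotone_nat_of_le_succ fun r => by
    rw [Function.iterate_succ_apply]
    exact hf.iterate r (Set.empty_subset _)

theorem iterate_empty_subset_mu (hf : Monotone f) (r : ℕ) : f^[r] ∅ ⊆ mu f := by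
  induction r with
  | zero => exact Set.empty_subset _
  | succ r ih =>
    rw [Function.iterate_succ_apply', ← map_mu hf]
    exact hf ih

/-- This makes approximants with equal counters comparable when the enclosing variables change,
which the table of the algorithm relies on. -/
theorem iterate_empty_mono_left (hf : Monotone f) (h : ∀ X, f X ⊆ g X) (r : ℕ) :
    f^[r] (∅ : Set V) ⊆ g^[r] ∅ := by
  induction r with
  | zero => exact subset_rfl
  | succ r ih =>
    rw [Function.iterate_succ_apply', Function.iterate_succ_apply']
    exact (hf ih).trans (h _)

theorem mu_eq_of_iterate_eq (hf : Monotone f) {r : ℕ} (h : f (f^[r] ∅) = f^[r] ∅) :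
    mu f = f^[r] ∅ :=
  (mu_subset h.subset).antisymm (iterate_empty_subset_mu hf r)

/-- Until the approximants stabilize, each round adds a vertex. After `|V|` rounds they are
therefore stable or already contain every vertex. -/
theorem mu_eq_iterate [Fintype V] (hf : Monotone f) : mu f = f^[Fintype.card V] ∅ := by
  have key : ∀ r, f (f^[r] ∅) = f^[r] ∅ ∨ r ≤ (f^[r] (∅ : Set V)).ncard := by
    intro r
    induction r with
    | zero => simp
    | succ r ih =>
      by_cases h : f (f^[r] ∅) = f^[r] ∅
      · left
        rw [Function.iterate_succ_apply' f r, h, h]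
      · right
        have h1 : f^[r] (∅ : Set V) ⊂ f^[r + 1] ∅ := by
          refine lt_of_le_of_ne (iterate_empty_mono hf (Nat.le_succ r)) fun h2 => h ?_
          rw [← Function.iterate_succ_apply' f r]
          exact h2.symm
        have h2 := Set.ncard_lt_ncard h1 (Set.toFinite _)
        have h3 := ih.resolve_left h
        omega
  rcases key (Fintype.card V) with h | h
  · exact mu_eq_of_iterate_eq hf h
  · have h1 : f^[Fintype.card V] (∅ : Set V) = Set.univ := by
      refine Set.eq_of_subset_of_ncard_le (Set.subset_univ _) ?_ (Set.toFinite _)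
      rwa [Set.ncard_univ, Nat.card_eq_fintype_card]
    exact (iterate_empty_subset_mu hf _).antisymm' (h1 ▸ Set.subset_univ _)

end Lattice

/-! ### The fixpoint expression in terms of the enclosing sets -/

section Below

variable {V : Type*} (𝒢 : LiveGame V)

theorem cpre_mono {S T : Set V} (h : S ⊆ T) : cpre 𝒢 S ⊆ cpre 𝒢 T := by
  rintro v (⟨hv, w, hw, hwS⟩ | ⟨hv, hw⟩)
  · exact Or.inl ⟨hv, w, hw, h hwS⟩
  · exact Or.inr ⟨hv, fun w hvw => h (hw w hvw)⟩

theorem preForall1_mono {S T : Set V} (h : S ⊆ T) : preForall1 𝒢 S ⊆ preForall1 𝒢 T :=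
  fun _ hv => ⟨hv.1, fun w hw => h (hv.2 w hw)⟩

theorem lpre_mono {S T : Set V} (h : S ⊆ T) : lpre 𝒢 S ⊆ lpre 𝒢 T :=
  fun _ ⟨w, hw, hwS⟩ => ⟨w, hw, h hwS⟩

theorem apre_mono {S S' T T' : Set V} (h : S ⊆ S') (h' : T ⊆ T') :
    apre 𝒢 S T ⊆ apre 𝒢 S' T' :=
  Set.union_subset_union (cpre_mono 𝒢 h')
    (Set.inter_subset_inter (lpre_mono 𝒢 h') (preForall1_mono 𝒢 h))

/-- `S` together with the set `C` of a level whose enclosing vertex set is `Q`. -/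
def enlarge (Q S G Y X : Set V) : Set V := S ∪ Q ∩ (G ∩ cpre 𝒢 Y ∪ apre 𝒢 Y X)

theorem enlarge_mono (Q G : Set V) {S S' Y Y' X X' : Set V} (hS : S ⊆ S') (hY : Y ⊆ Y')
    (hX : X ⊆ X') : enlarge 𝒢 Q S G Y X ⊆ enlarge 𝒢 Q S' G Y' X' :=
  Set.union_subset_union hS (Set.inter_subset_inter subset_rfl (Set.union_subset_union
    (Set.inter_subset_inter subset_rfl (cpre_mono 𝒢 hY)) (apre_mono 𝒢 hY hX)))

/-- The set transformer of the `μ`-variable of a level. -/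
def levelStep (next : Set V → Set V) (Q S G Y X : Set V) : Set V := next (enlarge 𝒢 Q S G Y X)

/-- The set transformer of the `ν`-variable of a level. -/
def levelBody (next : Set V → Set V) {m : ℕ} (goal : Fin m → Set V) (Q S Y : Set V) : Set V :=
  ⋂ l, mu (levelStep 𝒢 next Q S (goal l) Y)

/-- The value of a level. -/
def levelFix (next : Set V → Set V) {m : ℕ} (goal : Fin m → Set V) (Q S : Set V) : Set V :=
  nu (levelBody 𝒢 next goal Q S)

variable {𝒢} {next : Set V → Set V}

theorem levelFix_def {m : ℕ} (goal : Fin m → Set V) (Q S : Set V) : levelFix 𝒢 next goal Q S =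
    nu fun Y => ⋂ l, mu fun X => next (enlarge 𝒢 Q S (goal l) Y X) := rfl

theorem levelStep_mono (hn : Monotone next) (Q G : Set V) {S S' Y Y' X X' : Set V}
    (hS : S ⊆ S') (hY : Y ⊆ Y') (hX : X ⊆ X') :
    levelStep 𝒢 next Q S G Y X ⊆ levelStep 𝒢 next Q S' G Y' X' :=
  hn (enlarge_mono 𝒢 Q G hS hY hX)

theorem monotone_levelStep (hn : Monotone next) (Q S G Y : Set V) :
    Monotone (levelStep 𝒢 next Q S G Y) :=
  fun _ _ h => levelStep_mono hn Q G subset_rfl subset_rfl h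

theorem levelBody_mono (hn : Monotone next) {m : ℕ} (goal : Fin m → Set V) (Q : Set V)
    {S S' Y Y' : Set V} (hS : S ⊆ S') (hY : Y ⊆ Y') :
    levelBody 𝒢 next goal Q S Y ⊆ levelBody 𝒢 next goal Q S' Y' :=
  Set.iInter_mono fun _ => mu_mono fun _ => levelStep_mono hn _ _ hS hY subset_rfl

theorem monotone_levelBody (hn : Monotone next) {m : ℕ} (goal : Fin m → Set V) (Q S : Set V) :
    Monotone (levelBody 𝒢 next goal Q S) :=
  fun _ _ h => levelBody_mono hn goal Q subset_rfl h

theorem monotone_levelFix (hn : Monotone next) {m : ℕ} (goal : Fin m → Set V) (Q : Set V) :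
    Monotone (levelFix 𝒢 next goal Q) :=
  fun _ _ h => nu_mono fun _ => levelBody_mono hn goal Q h subset_rfl

theorem subset_levelFix (hn : ∀ S, S ⊆ next S) (hm : Monotone next) {m : ℕ}
    (goal : Fin m → Set V) (Q S : Set V) : S ⊆ levelFix 𝒢 next goal Q S := by
  refine subset_nu (Set.subset_iInter fun l => ?_)
  rw [← map_mu (monotone_levelStep hm _ _ _ _)]
  exact Set.subset_union_left.trans (hn _)

variable (𝒢) {k : ℕ} (𝓡 : GenRabin V k)

/-- The part of the fixpoint expression below some level, as a function of the intersection `Q` of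
the complements of the sets `R` and of the union `S` of the sets `C` of the enclosing levels. -/
def below : ℕ → Finset (Fin k) → Set V → Set V → Set V
  | 0, _, _, S => S
  | d + 1, P, Q, S => ⋃ p ∈ P,
      levelFix 𝒢 (below d (P.erase p) (Q ∩ (𝓡.R p)ᶜ)) (𝓡.G p) (Q ∩ (𝓡.R p)ᶜ) S

theorem monotone_below (d : ℕ) (P : Finset (Fin k)) (Q : Set V) :
    Monotone (below 𝒢 𝓡 d P Q) := by
  induction d generalizing P Q with
  | zero => exact fun _ _ h => h
  | succ d ih =>
    exact fun S T h => Set.iUnion₂_mono fun p _ => monotone_levelFix (ih _ _) _ _ h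

/-- The cardinality hypothesis guarantees a pair at every level; an empty union would lose `S`. -/
theorem subset_below {d : ℕ} {P : Finset (Fin k)} (hP : P.card = d) (Q S : Set V) :
    S ⊆ below 𝒢 𝓡 d P Q S := by
  induction d generalizing P Q S with
  | zero => exact subset_rfl
  | succ d ih =>
    obtain ⟨p, hp⟩ : P.Nonempty := Finset.card_pos.mp (by omega)
    refine Set.Subset.trans ?_ (Set.subset_iUnion₂ p hp)
    refine subset_levelFix (fun S => ih ?_ _ S) (monotone_below _ _ _ _ _) _ _ _
    rw [Finset.card_erase_of_mem hp, hP, Nat.add_sub_cancel]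

theorem levelFix_subset_below {d : ℕ} {P : Finset (Fin k)} {p : Fin k} (hp : p ∈ P)
    (Q S : Set V) :
    levelFix 𝒢 (below 𝒢 𝓡 d (P.erase p) (Q ∩ (𝓡.R p)ᶜ)) (𝓡.G p) (Q ∩ (𝓡.R p)ᶜ) S ⊆
      below 𝒢 𝓡 (d + 1) P Q S :=
  Set.subset_iUnion₂ (s := fun p _ =>
    levelFix 𝒢 (below 𝒢 𝓡 d (P.erase p) (Q ∩ (𝓡.R p)ᶜ)) (𝓡.G p) (Q ∩ (𝓡.R p)ᶜ) S) p hp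

theorem mem_matrix {env : List (Level V)} {v : V} : v ∈ matrix 𝒢 env ↔
    ∃ j, ∃ hj : j < env.length, (∀ i (hi : i < env.length), i ≤ j → v ∉ (env[i]).bad) ∧
      v ∈ (env[j].goal ∩ cpre 𝒢 env[j].Y) ∪ apre 𝒢 env[j].Y env[j].X := by
  simp only [matrix, Set.mem_iUnion, Set.mem_inter_iff, Set.mem_iInter, Fin.exists_iff,
    Fin.forall_iff, Fin.mk_le_mk, Set.mem_compl_iff]
  rfl

/-- The set `C` of a level is restricted only by the sets `R` of this level and of those outside it.
A new innermost level thus leaves the earlier sets `C` unchanged. -/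
theorem matrix_append (env : List (Level V)) (L : Level V) :
    matrix 𝒢 (env ++ [L]) = enlarge 𝒢 ({v | ∀ A ∈ env, v ∉ A.bad} ∩ L.badᶜ) (matrix 𝒢 env)
      L.goal L.Y L.X := by
  ext v
  rw [enlarge, Set.mem_union, mem_matrix, mem_matrix]
  constructor
  · rintro ⟨j, hj, h1, h2⟩
    rcases Nat.lt_or_ge j env.length with hjl | hjl
    · left
      refine ⟨j, hjl, fun i hi hij => ?_, ?_⟩
      · have := h1 i (by simp; omega) hij
        rwa [List.getElem_append_left hi] at this
      · simpa [List.getElem_append_left hjl] using h2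
    · right
      have hjl : j = env.length := by simp at hj; omega
      subst hjl
      refine ⟨⟨fun A hA => ?_, ?_⟩, ?_⟩
      · obtain ⟨i, hi, rfl⟩ := List.getElem_of_mem hA
        have := h1 i (by simp; omega) hi.le
        rwa [List.getElem_append_left hi] at this
      · simpa using h1 env.length hj le_rfl
      · simpa using h2
  · rintro (⟨j, hj, h1, h2⟩ | ⟨⟨h1, h1'⟩, h2⟩)
    · refine ⟨j, by simp; omega, fun i hi hij => ?_, ?_⟩
      · rw [List.getElem_append_left (hij.trans_lt hj)]
        exact h1 i _ hij
      · simpa [List.getElem_append_left hj] using h2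
    · refine ⟨env.length, by simp, fun i hi hij => ?_, by simpa using h2⟩
      rcases Nat.lt_or_ge i env.length with hil | hil
      · rw [List.getElem_append_left hil]
        exact h1 _ (List.getElem_mem hil)
      · have hil : i = env.length := by omega
        subst hil
        simpa using h1'

theorem fixpointBelow_eq_below (d : ℕ) (P : Finset (Fin k)) (env : List (Level V)) :
    fixpointBelow 𝒢 𝓡 d P env =
      below 𝒢 𝓡 d P {v | ∀ A ∈ env, v ∉ A.bad} (matrix 𝒢 env) := by
  induction d generalizing P env with
  | zero => rfl
  | succ d ih =>
    have hQ (L : Level V) : {v | ∀ A ∈ env ++ [L], v ∉ A.bad} =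
        {v | ∀ A ∈ env, v ∉ A.bad} ∩ L.badᶜ := by
      ext v
      simp [or_imp, forall_and]
    simp only [fixpointBelow, below, levelFix_def, ih, matrix_append, hQ]

theorem fixpoint_eq_levelFix : fixpoint 𝒢 𝓡 =
    levelFix 𝒢 (below 𝒢 𝓡 k Finset.univ Set.univ) (fun _ : Fin 1 => ∅) Set.univ ∅ := by
  have h0 : matrix 𝒢 [] = ∅ := by
    ext v
    simp [mem_matrix]
  have h (Y X : Set V) : matrix 𝒢 [⟨∅, ∅, Y, X⟩] = enlarge 𝒢 Set.univ ∅ ∅ Y X := by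
    have := matrix_append 𝒢 [] ⟨∅, ∅, Y, X⟩
    simpa [h0] using this
  have hQ (Y X : Set V) : {v | ∀ A ∈ [(⟨∅, ∅, Y, X⟩ : Level V)], v ∉ A.bad} = Set.univ := by
    ext v
    simp
  simp only [fixpoint, fixpointBelow_eq_below, h, hQ, levelFix_def, Set.iInter_const]

end Below

/-! ### Plays that evade a generalized Rabin condition -/

section Evasion

variable {V N : Type*} {k : ℕ}

/-- The word `l` leads from `x` to `y`, along the relation `nxt`; it contains `x` but not `y`. -/
inductive Path (nxt : N → N → Prop) : N → List N → N → Prop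
  | nil (x : N) : Path nxt x [] x
  | cons {x z y : N} {l : List N} : nxt x z → Path nxt z l y → Path nxt x (x :: l) y

variable {nxt : N → N → Prop} {lab : N → V}

theorem Path.append {x y z : N} {l l' : List N} (h : Path nxt x l y) (h' : Path nxt y l' z) :
    Path nxt x (l ++ l') z := by
  induction h with
  | nil => exact h'
  | cons hxz _ ih => exact .cons hxz (ih h')

theorem Path.single {x y : N} (h : nxt x y) : Path nxt x [x] y := .cons h (.nil y)

theorem Path.head_eq {x y : N} {l : List N} (h : Path nxt x l y) : ∃ l', l ++ [y] = x :: l' := by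
  cases h with
  | nil => exact ⟨[], rfl⟩
  | cons _ _ => exact ⟨_, rfl⟩

theorem Path.isChain {x y : N} {l : List N} (h : Path nxt x l y) :
    (l ++ [y]).IsChain nxt := by
  induction h with
  | nil => simp
  | cons hxz h ih =>
    obtain ⟨l', hl'⟩ := h.head_eq
    rw [List.cons_append, hl']
    rw [hl'] at ih
    exact List.isChain_cons_cons.mpr ⟨hxz, ih⟩

/-- Along the word `l` followed by `y`, the edge `(u, w)` is taken. -/
def Taken (lab : N → V) (l : List N) (y : N) (u w : V) : Prop :=
  ∃ l₁ z z' l₂, l ++ [y] = l₁ ++ z :: z' :: l₂ ∧ lab z = u ∧ lab z' = w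

theorem Taken.append_left {l l' : List N} {y : N} {u w : V} (h : Taken lab l' y u w) :
    Taken lab (l ++ l') y u w := by
  obtain ⟨l₁, z, z', l₂, h, hz⟩ := h
  exact ⟨l ++ l₁, z, z', l₂, by rw [List.append_assoc, h, List.append_assoc], hz⟩

theorem Taken.append_right {l l' : List N} {y y' : N} {u w : V} (h : Taken lab l y u w)
    (hp : Path nxt y l' y') : Taken lab (l ++ l') y' u w := by
  obtain ⟨l₁, z, z', l₂, h, hz⟩ := h
  obtain ⟨l'', hl''⟩ := hp.head_eq
  refine ⟨l₁, z, z', l₂ ++ l'', ?_, hz⟩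
  rw [List.append_assoc, hl'', ← List.singleton_append, ← List.append_assoc, h]
  simp

theorem taken_of_nxt {l l' : List N} {z z' y : N} (h : Path nxt z' l' y) :
    Taken lab (l ++ z :: l') y (lab z) (lab z') := by
  obtain ⟨l'', hl''⟩ := h.head_eq
  exact ⟨l, z, z', l'', by rw [List.append_assoc, List.cons_append, hl''], rfl, rfl⟩

variable (𝒢 : LiveGame V) (𝓡 : GenRabin V k)

/-- The pair `p` is satisfied by `π`. -/
def GenRabin.SatPair (p : Fin k) (π : ℕ → V) : Prop :=
  (∀ᶠ i in atTop, π i ∉ 𝓡.R p) ∧ ∀ l : Fin (𝓡.m p), ∃ᶠ i in atTop, π i ∈ 𝓡.G p l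

/-- From `x` there is a finite path through `A` to a node in `B`. -/
def Escape (nxt : N → N → Prop) (lab : N → V) (A B : Set V) (x : N) : Prop :=
  ∃ l y, Path nxt x l y ∧ (∀ z ∈ l, lab z ∈ A) ∧ lab y ∈ B

/-- From `x` there is an infinite fair path in `A` that violates the pairs in `P`. -/
def Evade (nxt : N → N → Prop) (lab : N → V) (A : Set V) (P : Finset (Fin k)) (x : N) : Prop :=
  ∃ π : ℕ → N, π 0 = x ∧ (∀ i, nxt (π i) (π (i + 1))) ∧ (∀ i, lab (π i) ∈ A) ∧
    (fun i => lab (π i)) ∈ fairPlays 𝒢 ∧ ∀ p ∈ P, ¬ 𝓡.SatPair p fun i => lab (π i)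

variable {𝒢 𝓡}

theorem frequently_succ {p : ℕ → Prop} : (∃ᶠ i in atTop, p (i + 1)) ↔ ∃ᶠ i in atTop, p i := by
  conv_rhs => rw [← map_add_atTop_eq_nat 1, frequently_map]

theorem eventually_succ {p : ℕ → Prop} : (∀ᶠ i in atTop, p (i + 1)) ↔ ∀ᶠ i in atTop, p i := by
  conv_rhs => rw [← map_add_atTop_eq_nat 1, eventually_map]

theorem fairPlays_succ {π : ℕ → V} (h : (fun i => π (i + 1)) ∈ fairPlays 𝒢) :
    π ∈ fairPlays 𝒢 := fun v w hvw hv =>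
  frequently_succ.mp (h v w hvw (frequently_succ (p := fun i => π i = v).mpr hv))

theorem satPair_succ {π : ℕ → V} {p : Fin k} :
    𝓡.SatPair p (fun i => π (i + 1)) ↔ 𝓡.SatPair p π :=
  and_congr (eventually_succ (p := fun i => π i ∉ 𝓡.R p))
    (forall_congr' fun l => frequently_succ (p := fun i => π i ∈ 𝓡.G p l))

theorem Evade.cons {A : Set V} {P : Finset (Fin k)} {x y : N} (hxy : nxt x y) (hx : lab x ∈ A)
    (h : Evade 𝒢 𝓡 nxt lab A P y) : Evade 𝒢 𝓡 nxt lab A P x := by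
  obtain ⟨π, h0, h1, h2, h3, h4⟩ := h
  refine ⟨fun i => Nat.casesOn i x π, rfl, ?_, ?_, fairPlays_succ h3, fun p hp hs => ?_⟩
  · rintro (_ | i)
    · simpa [h0] using hxy
    · exact h1 i
  · rintro (_ | i)
    · exact hx
    · exact h2 i
  · exact h4 p hp (satPair_succ.mpr hs)

theorem Evade.prepend {A : Set V} {P : Finset (Fin k)} {x y : N} {l : List N}
    (hp : Path nxt x l y) (hl : ∀ z ∈ l, lab z ∈ A) (h : Evade 𝒢 𝓡 nxt lab A P y) :
    Evade 𝒢 𝓡 nxt lab A P x := by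
  induction hp with
  | nil => exact h
  | cons hxz _ ih =>
    exact (ih (fun z hz => hl z (List.mem_cons_of_mem _ hz)) h).cons hxz (hl _ (by simp))

theorem Escape.prepend {A B : Set V} {x y : N} {l : List N}
    (hp : Path nxt x l y) (hl : ∀ z ∈ l, lab z ∈ A) (h : Escape nxt lab A B y) :
    Escape nxt lab A B x := by
  obtain ⟨l', z, hp', hl', hz⟩ := h
  refine ⟨l ++ l', z, hp.append hp', fun a ha => ?_, hz⟩
  rcases List.mem_append.mp ha with ha | ha
  exacts [hl a ha, hl' a ha]

theorem Evade.mono {A A' : Set V} {P P' : Finset (Fin k)} {x : N} (hA : A ⊆ A')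
    (h : Evade 𝒢 𝓡 nxt lab A P x)
    (hP : ∀ p ∈ P', p ∈ P ∨ ∀ π : ℕ → V, (∀ i, π i ∈ A) → ¬ 𝓡.SatPair p π) :
    Evade 𝒢 𝓡 nxt lab A' P' x := by
  obtain ⟨π, h0, h1, h2, h3, h4⟩ := h
  exact ⟨π, h0, h1, fun i => hA (h2 i), h3, fun p hp =>
    (hP p hp).elim (h4 p) fun h => h _ h2⟩

/-- Infinitely many non-empty finite paths, each starting where the previous one ends, form an
infinite path; `a n` is the position at which the path number `n` starts. -/
theorem exists_concat (x : ℕ → N) (l : ℕ → List N) (hl : ∀ n, l n ≠ [])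
    (hp : ∀ n, Path nxt (x n) (l n) (x (n + 1))) :
    ∃ (π : ℕ → N) (a : ℕ → ℕ), StrictMono a ∧ a 0 = 0 ∧ (∀ n, a (n + 1) = a n + (l n).length) ∧
      (∀ i, nxt (π i) (π (i + 1))) ∧ (∀ i, ∃ n j, j < (l n).length ∧ i = a n + j) ∧
      ∀ n j, j ≤ (l n).length → (l n ++ [x (n + 1)])[j]? = some (π (a n + j)) := by
  set a : ℕ → ℕ := fun n => ∑ j ∈ Finset.range n, (l j).length with ha
  have ha0 : a 0 = 0 := by simp [ha]
  have has (n) : a (n + 1) = a n + (l n).length := by simp [ha, Finset.sum_range_succ]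
  have hlen (n) : 0 < (l n).length := List.length_pos_iff.mpr (hl n)
  have hmono : StrictMono a := strictMono_nat_of_lt_succ fun n => by
    have := hlen n
    have := has n
    omega
  have hidx (i : ℕ) : ∃ n, a n ≤ i ∧ i < a (n + 1) := by
    induction i with
    | zero => exact ⟨0, by simp [ha0], by have := has 0; have := hlen 0; omega⟩
    | succ i ih =>
      obtain ⟨n, h1, h2⟩ := ih
      rcases Nat.lt_or_ge (i + 1) (a (n + 1)) with h | h
      · exact ⟨n, by omega, h⟩
      · exact ⟨n + 1, h, by have := has (n + 1); have := hlen (n + 1); omega⟩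
  -- `idx i` is the number of the path that covers position `i`.
  choose idx hidx1 hidx2 using hidx
  have huniq (n j : ℕ) (hj : j < (l n).length) : idx (a n + j) = n := by
    have h1 := hidx1 (a n + j)
    have h2 := hidx2 (a n + j)
    have h3 : idx (a n + j) < n + 1 := hmono.lt_iff_lt.mp (by have := has n; omega)
    have h4 : n < idx (a n + j) + 1 := hmono.lt_iff_lt.mp (by omega)
    omega
  have hget (i : ℕ) : i - a (idx i) < (l (idx i)).length := by
    have := hidx1 i
    have := hidx2 i
    have := has (idx i)
    omega
  set π : ℕ → N := fun i => (l (idx i))[i - a (idx i)]'(hget i) with hπ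
  have hπlt (n j : ℕ) (hj : j < (l n).length) : π (a n + j) = (l n)[j] := by
    have h := huniq n j hj
    simp only [hπ]
    congr 1
    · rw [h]
    · rw [h]; omega
  -- Including `j = (l n).length`, the first position of the next path, makes edges across the joint
  -- visible as well.
  have hget' (n j : ℕ) (hj : j ≤ (l n).length) :
      (l n ++ [x (n + 1)])[j]? = some (π (a n + j)) := by
    rcases hj.lt_or_eq with hj | rfl
    · rw [hπlt n j hj, List.getElem?_append_left hj, List.getElem?_eq_getElem hj]
    · have h0 := hπlt (n + 1) 0 (hlen _)
      rw [Nat.add_zero, has] at h0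
      rw [h0]
      obtain ⟨l', hl'⟩ := (hp (n + 1)).head_eq
      have h1 := congrArg (fun t => t[0]?) hl'
      simp only [List.getElem?_append_left (hlen (n + 1)), List.getElem?_cons_zero,
        List.getElem?_eq_getElem (hlen (n + 1)), Option.some.injEq] at h1
      simp [h1]
  have hdec (i : ℕ) : ∃ n j, j < (l n).length ∧ i = a n + j :=
    ⟨idx i, i - a (idx i), hget i, by have := hidx1 i; omega⟩
  refine ⟨π, a, hmono, ha0, has, fun i => ?_, hdec, hget'⟩
  obtain ⟨n, j, hj, rfl⟩ := hdec i
  have h1 := hget' n j hj.le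
  have h2 := hget' n (j + 1) hj
  have hc := List.isChain_iff_getElem.mp (hp n).isChain j (by simp; omega)
  rw [List.getElem?_eq_some_iff] at h1 h2
  obtain ⟨_, h1⟩ := h1
  obtain ⟨_, h2⟩ := h2
  rwa [h1, h2] at hc

end Evasion

/-! ### Fair paths from finite segments, and the induction over the levels. -/

section Evasion

variable {V N : Type*} {k : ℕ}
variable {nxt : N → N → Prop} {lab : N → V}
variable {𝒢 : LiveGame V} {𝓡 : GenRabin V k}

/-- Lets every live successor of a vertex come up infinitely often. -/
theorem exists_enumeration (α : Type*) [Countable α] [Nonempty α] :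
    ∃ e : ℕ → α, ∀ a b, ∃ t ≥ b, e t = a := by
  obtain ⟨s, hs⟩ := exists_surjective_nat α
  refine ⟨fun t => s t.unpair.1, fun a b => ?_⟩
  obtain ⟨i, rfl⟩ := hs a
  exact ⟨Nat.pair i b, Nat.right_le_pair i b, by simp⟩

/-- An unbounded counter that moves by at most one skips no value, and `p` holds at the moment it
steps beyond `t`. -/
theorem exists_counter_eq {c : ℕ → ℕ} {p : ℕ → Prop} [DecidablePred p]
    (hc : ∀ n, c (n + 1) = if p n then c n + 1 else c n) (hp : ∀ b, ∃ n ≥ b, p n) (b t : ℕ)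
    (hbt : c b ≤ t) : ∃ n ≥ b, p n ∧ c n = t := by
  have hmono : Monotone c := monotone_nat_of_le_succ fun n => by
    rw [hc]
    split_ifs <;> omega
  have hub : ∃ n, t < c (b + n) := by
    clear hbt
    induction t with
    | zero =>
      obtain ⟨n, hn, hpn⟩ := hp b
      refine ⟨n - b + 1, ?_⟩
      rw [show b + (n - b + 1) = n + 1 by omega, hc, if_pos hpn]
      omega
    | succ t ih =>
      obtain ⟨n, hn⟩ := ih
      obtain ⟨n', hn', hpn⟩ := hp (b + n)
      refine ⟨n' - b + 1, ?_⟩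
      have := hmono hn'
      rw [show b + (n' - b + 1) = n' + 1 by omega, hc, if_pos hpn]
      omega
  classical
  have h1 := Nat.find_spec hub
  set n := Nat.find hub with hn
  rcases Nat.eq_zero_or_pos n with h0 | h0
  · rw [h0, Nat.add_zero] at h1
    omega
  · have h2 : ¬ t < c (b + (n - 1)) := Nat.find_min hub (by omega)
    have h3 := hc (b + (n - 1))
    rw [show b + (n - 1) + 1 = b + n by omega] at h3
    refine ⟨b + (n - 1), by omega, ?_⟩
    split_ifs at h3 with h4
    · exact ⟨h4, by omega⟩
    · omega

/-- If finite paths that visit all sets `R` and take a prescribed live edge out of every visited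
vertex that has live edges can be found again and again, then they form an evading path. -/
theorem evade_of_segments {W : Set N} {A : Set V} {P : Finset (Fin k)}
    (hseg : ∀ x ∈ W, ∀ c : V → V, (∀ u w, 𝒢.El u w → 𝒢.El u (c u)) →
      ∃ l y, Path nxt x l y ∧ l ≠ [] ∧ (∀ z ∈ l, lab z ∈ A) ∧ y ∈ W ∧
        (∀ p ∈ P, ∃ z ∈ l, lab z ∈ 𝓡.R p) ∧
        ∀ u w, 𝒢.El u w → (∃ z ∈ l, lab z = u) → Taken lab l y u (c u))
    [Finite V] {x : N} (hx : x ∈ W) : Evade 𝒢 𝓡 nxt lab A P x := by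
  classical
  have henum (u : V) : ∃ e : ℕ → V, (∀ t w, 𝒢.El u w → 𝒢.El u (e t)) ∧
      ∀ w, 𝒢.El u w → ∀ b, ∃ t ≥ b, e t = w := by
    by_cases h : ∃ w, 𝒢.El u w
    · have : Nonempty {w // 𝒢.El u w} := let ⟨w, hw⟩ := h; ⟨⟨w, hw⟩⟩
      obtain ⟨e, he⟩ := exists_enumeration {w // 𝒢.El u w}
      refine ⟨fun t => e t, fun t _ _ => (e t).2, fun w hw b => ?_⟩
      obtain ⟨t, ht, h⟩ := he ⟨w, hw⟩ b
      exact ⟨t, ht, by simp [h]⟩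
    · push Not at h
      exact ⟨fun _ => u, fun _ w hw => (h w hw).elim, fun w hw => (h w hw).elim⟩
  choose e he1 he2 using henum
  have hseg' (s : W × (V → ℕ)) := hseg s.1 s.1.2 (fun u => e u (s.2 u)) fun u => he1 u _
  choose l y hp hne hA hW hR hT using hseg'
  -- The state is the current node and, for each vertex `u`, the number of segments so far that
  -- visited `u`. This number selects the live edge `e u` to be taken in the next segment that
  -- visits `u`.
  let step : W × (V → ℕ) → W × (V → ℕ) := fun s =>
    (⟨y s, hW s⟩, fun u => if ∃ z ∈ l s, lab z = u then s.2 u + 1 else s.2 u)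
  let s : ℕ → W × (V → ℕ) := fun n => step^[n] (⟨x, hx⟩, fun _ => 0)
  have hs (n) : s (n + 1) = step (s n) := Function.iterate_succ_apply' _ _ _
  obtain ⟨π, a, hmono, ha0, has, hπ, hdec, hget⟩ :=
    exists_concat (nxt := nxt) (fun n => ((s n).1 : N)) (fun n => l (s n)) (fun n => hne _)
      (fun n => by rw [hs]; exact hp (s n))
  have hmem (n j) (hj : j < (l (s n)).length) : π (a n + j) ∈ l (s n) := by
    have := hget n j hj.le
    rw [List.getElem?_append_left hj] at this
    exact List.mem_of_getElem? this
  have hmem' (n) (z) (hz : z ∈ l (s n)) : ∃ j, π (a n + j) = z := by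
    obtain ⟨j, hj, rfl⟩ := List.getElem_of_mem hz
    have := hget n j hj.le
    rw [List.getElem?_append_left hj, List.getElem?_eq_getElem hj] at this
    exact ⟨j, (Option.some.inj this).symm⟩
  refine ⟨π, ?_, hπ, fun i => ?_, fun u w huw hu => ?_, fun p hp' hs' => ?_⟩
  · have h0 := hget 0 0 (Nat.zero_le _)
    obtain ⟨l', hl'⟩ := (hp (s 0)).head_eq
    have h1 : l (s 0) ++ [((s (0 + 1)).1 : N)] = x :: l' := by rw [hs]; exact hl'
    rw [h1, ha0] at h0
    simpa using h0.symm
  · obtain ⟨n, j, hj, rfl⟩ := hdec i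
    exact hA _ _ (hmem n j hj)
  · rw [frequently_atTop] at hu ⊢
    intro b
    have hvis (b : ℕ) : ∃ n ≥ b, ∃ z ∈ l (s n), lab z = u := by
      obtain ⟨i, hi, hiu⟩ := hu (a b)
      obtain ⟨n, j, hj, rfl⟩ := hdec i
      refine ⟨n, ?_, _, hmem n j hj, hiu⟩
      have h1 : a b < a (n + 1) := by rw [has]; omega
      have h2 := hmono.lt_iff_lt.mp h1
      omega
    have hc (n : ℕ) : (s (n + 1)).2 u =
        if ∃ z ∈ l (s n), lab z = u then (s n).2 u + 1 else (s n).2 u := by rw [hs]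
    obtain ⟨t, ht, hew⟩ := he2 u w huw ((s b).2 u)
    -- A later segment visits `u` while its counter has the value assigned to `w`, and so takes the
    -- edge to `w`.
    obtain ⟨n, hn, hvn, hcn⟩ := exists_counter_eq (c := fun n => (s n).2 u) hc hvis b t ht
    obtain ⟨l₁, z, z', l₂, hl, hz, hz'⟩ := hT (s n) u w huw hvn
    rw [hcn, hew] at hz'
    have hl' : l (s n) ++ [((s (n + 1)).1 : N)] = l₁ ++ z :: z' :: l₂ := by rw [hs]; exact hl
    have hlen := congrArg List.length hl'
    simp only [List.length_append, List.length_cons, List.length_nil] at hlen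
    have h1 := hget n l₁.length (by omega)
    have h2 := hget n (l₁.length + 1) (by omega)
    rw [hl'] at h1 h2
    simp only [List.getElem?_append_right, le_refl, Nat.sub_self, List.getElem?_cons_zero,
      Option.some.injEq, Nat.le_add_right, Nat.add_sub_cancel_left,
      List.getElem?_cons_succ] at h1 h2
    have := hmono.le_apply (x := n)
    exact ⟨a n + l₁.length, by omega, (congrArg lab h1).symm.trans hz,
      (congrArg lab h2).symm.trans hz'⟩
  · obtain ⟨b, hb⟩ := eventually_atTop.mp hs'.1
    obtain ⟨z, hz, hzR⟩ := hR (s b) p hp'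
    obtain ⟨j, rfl⟩ := hmem' b z hz
    have := hmono.le_apply (x := b)
    exact hb _ (by omega) hzR

/-- From every node that is labelled outside `cpre X`, a step leads out of `X`, and all live edges
are available. -/
structure Unfolds (𝒢 : LiveGame V) (nxt : N → N → Prop) (lab : N → V) : Prop where
  leave : ∀ (x : N) (X : Set V), lab x ∉ cpre 𝒢 X → ∃ y, nxt x y ∧ lab y ∉ X
  live : ∀ (x : N) (w : V), 𝒢.El (lab x) w → ∃ y, nxt x y ∧ lab y = w

/-- The source of a live edge belongs to player 1, so `v ∈ cpre 𝒢 Y` means that all successors lie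
in `Y`. A live edge into `X` would then put `v` into `apre 𝒢 Y X`. -/
theorem notMem_enlarge {Q S G Y X : Set V} {v : V} (hv : v ∉ enlarge 𝒢 Q S G Y X) (hQ : v ∈ Q)
    (hY : v ∈ cpre 𝒢 Y) : v ∉ G ∧ v ∉ cpre 𝒢 X ∧ ∀ w, 𝒢.El v w → w ∉ X := by
  simp only [enlarge, apre, Set.mem_union, Set.mem_inter_iff, not_or, not_and] at hv
  obtain ⟨hG, hX, hl⟩ := hv.2 hQ
  refine ⟨fun h => hG h hY, hX, fun w hvw hw => hl ⟨w, hvw, hw⟩ ?_⟩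
  rcases hY with h | h
  · exact absurd h.1 (𝒢.live_edge v w hvw).1
  · exact h

/-- A path that visits `R p` and takes the edge `(u, c u)` out of every visited vertex `u ∈ L`,
obtained from paths that stop at the first vertex of `L`. -/
theorem exists_segment (hN : Unfolds 𝒢 nxt lab) {A X B : Set V} {out : N → Prop}
    (hout : ∀ {x y l}, Path nxt x l y → (∀ z ∈ l, lab z ∈ A) → out y → out x)
    (hA : ∀ v ∈ A, v ∉ cpre 𝒢 X ∧ ∀ w, 𝒢.El v w → w ∉ X)
    (hround : ∀ (L : Set V) (x : N), lab x ∉ X → out x ∨ ∃ l y, Path nxt x l y ∧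
      (∀ z ∈ l, lab z ∈ A \ L) ∧ lab y ∈ A ∧ (lab y ∈ L ∨ lab y ∈ B))
    {c : V → V} (L : Finset V) (hc : ∀ u ∈ L, 𝒢.El u (c u)) {x : N} (hx : lab x ∉ X) :
    out x ∨ ∃ l y, Path nxt x l y ∧ l ≠ [] ∧ (∀ z ∈ l, lab z ∈ A) ∧ lab y ∉ X ∧
      (∃ z ∈ l, lab z ∈ B) ∧ ∀ u ∈ L, (∃ z ∈ l, lab z = u) → Taken lab l y u (c u) := by
  classical
  -- At the first vertex of `L` the prescribed edge is taken. It leads outside `X`, so the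
  -- construction continues from there, and this vertex needs no further service in the segment.
  induction L using Finset.strongInduction generalizing x with
  | H L ih =>
    rcases hround L x hx with h | ⟨l, y, hp, hl, hyA, hy⟩
    · exact Or.inl h
    · by_cases hyL : lab y ∈ L
      · obtain ⟨z, hyz, hz⟩ := hN.live y _ (hc _ hyL)
        have hpz : Path nxt x (l ++ [y]) z := hp.append (.single hyz)
        have hlz : ∀ a ∈ l ++ [y], lab a ∈ A := by
          intro a ha
          rcases List.mem_append.mp ha with ha | ha
          · exact (hl a ha).1
          · rw [List.mem_singleton.mp ha]
            exact hyA
        rcases ih (L.erase (lab y)) (Finset.erase_ssubset hyL)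
          (fun u hu => hc u (Finset.mem_of_mem_erase hu)) (x := z)
          (by rw [hz]; exact (hA _ hyA).2 _ (hc _ hyL)) with h | ⟨l', y', hp', _, hl', hy', hB, hT⟩
        · exact Or.inl (hout hpz hlz h)
        · refine Or.inr ⟨(l ++ [y]) ++ l', y', hpz.append hp', by simp, fun a ha => ?_, hy', ?_, ?_⟩
          · rcases List.mem_append.mp ha with ha | ha
            exacts [hlz a ha, hl' a ha]
          · obtain ⟨a, ha, haB⟩ := hB
            exact ⟨a, List.mem_append_right _ ha, haB⟩
          · rintro u hu ⟨a, ha, rfl⟩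
            by_cases hay : lab a = lab y
            · rw [hay, ← hz, List.append_assoc, List.singleton_append]
              exact taken_of_nxt hp'
            · rcases List.mem_append.mp ha with ha | ha
              · rcases List.mem_append.mp ha with ha | ha
                · exact absurd hu (hl a ha).2
                · exact absurd (by rw [List.mem_singleton.mp ha]) hay
              · exact (hT _ (Finset.mem_erase.mpr ⟨hay, hu⟩) ⟨a, ha, rfl⟩).append_left
      -- One extra step puts the vertex of `B` into the word itself, which does not contain its
      -- endpoint.
      · obtain ⟨z, hyz, hz⟩ := hN.leave y X (hA _ hyA).1
        refine Or.inr ⟨l ++ [y], z, hp.append (.single hyz), by simp, fun a ha => ?_, hz,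
          ⟨y, by simp, hy.resolve_left hyL⟩, ?_⟩
        · rcases List.mem_append.mp ha with ha | ha
          · exact (hl a ha).1
          · rw [List.mem_singleton.mp ha]
            exact hyA
        · rintro u hu ⟨a, ha, rfl⟩
          rcases List.mem_append.mp ha with ha | ha
          · exact absurd hu (hl a ha).2
          · rw [List.mem_singleton.mp ha] at hu
            exact absurd hu hyL

/-- A path that visits the sets `R p`, `p ∈ P`, and takes the edge `(u, c u)` out of every visited
vertex `u ∈ L`. -/
theorem exists_segment_forall (hN : Unfolds 𝒢 nxt lab) {A X : Set V} {out : N → Prop}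
    (hout : ∀ {x y l}, Path nxt x l y → (∀ z ∈ l, lab z ∈ A) → out y → out x)
    (hA : ∀ v ∈ A, v ∉ cpre 𝒢 X ∧ ∀ w, 𝒢.El v w → w ∉ X)
    (hX : ∀ x, lab x ∉ X → out x ∨ lab x ∈ A)
    {L : Finset V} {c : V → V} (hc : ∀ u ∈ L, 𝒢.El u (c u)) (P : Finset (Fin k))
    (hseg : ∀ p ∈ P, ∀ x, lab x ∉ X → out x ∨ ∃ l y, Path nxt x l y ∧ l ≠ [] ∧
      (∀ z ∈ l, lab z ∈ A) ∧ lab y ∉ X ∧ (∃ z ∈ l, lab z ∈ 𝓡.R p) ∧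
      ∀ u ∈ L, (∃ z ∈ l, lab z = u) → Taken lab l y u (c u)) {x : N} (hx : lab x ∉ X) :
    out x ∨ ∃ l y, Path nxt x l y ∧ l ≠ [] ∧ (∀ z ∈ l, lab z ∈ A) ∧ lab y ∉ X ∧
      (∀ p ∈ P, ∃ z ∈ l, lab z ∈ 𝓡.R p) ∧
      ∀ u ∈ L, (∃ z ∈ l, lab z = u) → Taken lab l y u (c u) := by
  classical
  induction P using Finset.induction_on generalizing x with
  | empty =>
    rcases hX x hx with h | h
    · exact Or.inl h
    -- Even without pairs the segment needs one step, since concatenation requires non-empty words.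
    · obtain ⟨y, hxy, hy, hL⟩ : ∃ y, nxt x y ∧ lab y ∉ X ∧ (lab x ∈ L → lab y = c (lab x)) := by
        by_cases hL : lab x ∈ L
        · obtain ⟨y, hxy, hy⟩ := hN.live x _ (hc _ hL)
          exact ⟨y, hxy, hy ▸ (hA _ h).2 _ (hc _ hL), fun _ => hy⟩
        · obtain ⟨y, hxy, hy⟩ := hN.leave x X (hA _ h).1
          exact ⟨y, hxy, hy, fun h => absurd h hL⟩
      refine Or.inr ⟨[x], y, .single hxy, by simp, by simpa using h, hy, by simp, ?_⟩
      rintro u hu ⟨z, hz, rfl⟩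
      rw [List.mem_singleton.mp hz] at hu ⊢
      rw [← hL hu]
      exact taken_of_nxt (nxt := nxt) (l := []) (.nil y)
  | insert p P _ ih =>
    rcases hseg p (Finset.mem_insert_self p P) x hx with h | ⟨l, y, hp, hne, hl, hy, hR, hT⟩
    · exact Or.inl h
    · rcases ih (fun q hq => hseg q (Finset.mem_insert_of_mem hq)) hy with
        h | ⟨l', y', hp', _, hl', hy', hR', hT'⟩
      · exact Or.inl (hout hp hl h)
      · refine Or.inr ⟨l ++ l', y', hp.append hp', by simp [hne], fun a ha => ?_, hy', ?_, ?_⟩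
        · rcases List.mem_append.mp ha with ha | ha
          exacts [hl a ha, hl' a ha]
        · intro q hq
          rcases Finset.mem_insert.mp hq with rfl | hq
          · obtain ⟨z, hz, hzR⟩ := hR
            exact ⟨z, List.mem_append_left _ hz, hzR⟩
          · obtain ⟨z, hz, hzR⟩ := hR' q hq
            exact ⟨z, List.mem_append_right _ hz, hzR⟩
        · rintro u hu ⟨a, ha, hau⟩
          rcases List.mem_append.mp ha with ha | ha
          · exact (hT u hu ⟨a, ha, hau⟩).append_right hp'
          · exact (hT' u hu ⟨a, ha, hau⟩).append_left

/-- Let `x` be labelled outside of the value `below` of an expression. Then there is an infinite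
fair path from `x` that avoids `S` and `D` and violates the pairs of the expression, or a finite path
into `D` that avoids `S`, provided that outside `S` and `D` player 1 can return to the complement of
`X`, also along every live edge. -/
theorem escape_or_evade [Finite V] (hN : Unfolds 𝒢 nxt lab) {d : ℕ} {P : Finset (Fin k)}
    (hP : P.card = d) {Q S X D : Set V} (hD : Qᶜ ⊆ D) (hX : below 𝒢 𝓡 d P Q S ⊆ X)
    (hS : ∀ v ∉ S, v ∉ D → v ∉ cpre 𝒢 X ∧ ∀ w, 𝒢.El v w → w ∉ X) {x : N} (hx : lab x ∉ X) :
    Escape nxt lab (Sᶜ \ D) (Sᶜ ∩ D) x ∨ Evade 𝒢 𝓡 nxt lab (Sᶜ \ D) P x := by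
  classical
  induction d using Nat.strong_induction_on generalizing P Q S X D x with
  | _ d ih =>
  set out : N → Prop := fun x =>
    Escape nxt lab (Sᶜ \ D) (Sᶜ ∩ D) x ∨ Evade 𝒢 𝓡 nxt lab (Sᶜ \ D) P x with hout
  have hprep {x y : N} {l : List N} (hp : Path nxt x l y) (hl : ∀ z ∈ l, lab z ∈ Sᶜ \ D) :
      out y → out x := Or.imp (Escape.prepend hp hl) (Evade.prepend hp hl)
  have hSX : S ⊆ X := (subset_below 𝒢 𝓡 hP Q S).trans hX
  have hXA (x : N) (hx : lab x ∉ X) : out x ∨ lab x ∈ Sᶜ \ D := by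
    by_cases h : lab x ∈ D
    · exact Or.inl (Or.inl ⟨[], x, .nil x, by simp, fun h => hx (hSX h), h⟩)
    · exact Or.inr ⟨fun h => hx (hSX h), h⟩
  have hA (v) (hv : v ∈ Sᶜ \ D) := hS v hv.1 hv.2
  have hround (p : Fin k) (hp : p ∈ P) (L : Set V) : ∀ x : N, lab x ∉ X → out x ∨ ∃ l y,
      Path nxt x l y ∧ (∀ z ∈ l, lab z ∈ (Sᶜ \ D) \ L) ∧ lab y ∈ Sᶜ \ D ∧
      (lab y ∈ L ∨ lab y ∈ 𝓡.R p) := by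
    obtain ⟨d, rfl⟩ : ∃ d', d = d' + 1 :=
      Nat.exists_eq_succ_of_ne_zero (hP ▸ Finset.card_ne_zero_of_mem hp)
    set Q' := Q ∩ (𝓡.R p)ᶜ with hQ'
    have key : ∀ v ∉ levelFix 𝒢 (below 𝒢 𝓡 d (P.erase p) Q') (𝓡.G p) Q' S,
        ∀ x : N, lab x = v → out x ∨ ∃ l y, Path nxt x l y ∧
          (∀ z ∈ l, lab z ∈ (Sᶜ \ D) \ L) ∧ lab y ∈ Sᶜ \ D ∧
          (lab y ∈ L ∨ lab y ∈ 𝓡.R p) := by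
      -- Induction along the `ν`-stages of the pair `p`: from outside `Y` the claim is already
      -- known.
      refine notMem_nu_induction fun Y hY v hv x hx => ?_
      subst hx
      obtain ⟨g, hg⟩ : ∃ g, lab x ∉ mu (levelStep 𝒢 (below 𝒢 𝓡 d (P.erase p) Q') Q' S
          (𝓡.G p g) Y) := by
        simpa only [levelBody, Set.mem_iInter, not_forall] using hv
      set X' := mu (levelStep 𝒢 (below 𝒢 𝓡 d (P.erase p) Q') Q' S (𝓡.G p g) Y) with hX'
      set S' := enlarge 𝒢 Q' S (𝓡.G p g) Y X' with hS'
      -- The exits for the deeper levels: the old exits, the vertices of `L`, those excluded by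
      -- `Q'`, and those from which player 1 can leave `Y`. Off these exits and off `S'`,
      -- `notMem_enlarge` applies at this level.
      set D' := D ∪ (L ∪ (Q'ᶜ ∪ (cpre 𝒢 Y)ᶜ)) with hD'
      have hSS' : S ⊆ S' := Set.subset_union_left
      have hAA' : S'ᶜ \ D' ⊆ (Sᶜ \ D) \ L := fun v hv =>
        ⟨⟨fun h => hv.1 (hSS' h), fun h => hv.2 (Or.inl h)⟩, fun h => hv.2 (Or.inr (Or.inl h))⟩
      have hmid (v) (hv : v ∈ S'ᶜ \ D') :
          v ∉ 𝓡.G p g ∧ v ∉ cpre 𝒢 X' ∧ ∀ w, 𝒢.El v w → w ∉ X' := by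
        refine notMem_enlarge hv.1 (by_contra fun h => hv.2 ?_) (by_contra fun h => hv.2 ?_)
        · exact Or.inr (Or.inr (Or.inl h))
        · exact Or.inr (Or.inr (Or.inr h))
      rcases ih d (Nat.lt_succ_self d) (P := P.erase p) (Q := Q') (S := S') (X := X') (D := D')
        (by rw [Finset.card_erase_of_mem hp, hP, Nat.add_sub_cancel])
        (fun v hv => Or.inr (Or.inr (Or.inl hv)))
        (map_mu (monotone_levelStep (monotone_below 𝒢 𝓡 d _ Q') _ _ _ _)).subset
        (fun v h1 h2 => (hmid v ⟨h1, h2⟩).2) hg with ⟨l, y, hl, hlA, hyS, hy⟩ | h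
      · have hlA' : ∀ z ∈ l, lab z ∈ (Sᶜ \ D) \ L := fun z hz => hAA' (hlA z hz)
        have hyS' : lab y ∉ S := fun h => hyS (hSS' h)
        by_cases hyD : lab y ∈ D
        · exact Or.inl (Or.inl ⟨l, y, hl, fun z hz => (hlA' z hz).1, hyS', hyD⟩)
        by_cases hyL : lab y ∈ L
        · exact Or.inr ⟨l, y, hl, hlA', ⟨hyS', hyD⟩, Or.inl hyL⟩
        by_cases hyR : lab y ∈ 𝓡.R p
        · exact Or.inr ⟨l, y, hl, hlA', ⟨hyS', hyD⟩, Or.inr hyR⟩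
        -- Since `Qᶜ ⊆ D`, an exit through `Q'ᶜ` that avoids `D` would lie in `R p`. The only exit
        -- left leads out of `Y`, to an earlier stage.
        have hyQ : lab y ∈ Q' := ⟨by_contra fun h => hyD (hD h), hyR⟩
        have hyY : lab y ∉ cpre 𝒢 Y := by
          rcases hy with h | h | h | h
          exacts [absurd h hyD, absurd h hyL, absurd hyQ h, h]
        obtain ⟨z, hyz, hz⟩ := hN.leave y Y hyY
        have hlz : Path nxt x (l ++ [y]) z := hl.append (.single hyz)
        have hlzA : ∀ a ∈ l ++ [y], lab a ∈ (Sᶜ \ D) \ L := by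
          intro a ha
          rcases List.mem_append.mp ha with ha | ha
          · exact hlA' a ha
          · rw [List.mem_singleton.mp ha]
            exact ⟨⟨hyS', hyD⟩, hyL⟩
        rcases hY _ hz z rfl with h | ⟨l', y', hl', hlA'', h⟩
        · exact Or.inl (hprep hlz (fun a ha => (hlzA a ha).1) h)
        · refine Or.inr ⟨(l ++ [y]) ++ l', y', hlz.append hl', fun a ha => ?_, h⟩
          rcases List.mem_append.mp ha with ha | ha
          exacts [hlzA a ha, hlA'' a ha]
      · refine Or.inl (Or.inr (h.mono (fun v hv => (hAA' hv).1) fun q hq => ?_))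
        by_cases hqp : q = p
        · subst hqp
          -- The pair `p` is violated because the path never visits its goal set `g`.
          refine Or.inr fun π hπ hs => ?_
          obtain ⟨i, hi⟩ := (hs.2 g).exists
          exact (hmid _ (hπ i)).1 hi
        · exact Or.inl (Finset.mem_erase.mpr ⟨hqp, hq⟩)
    exact fun x hx => key _ (fun h => hx (hX (levelFix_subset_below 𝒢 𝓡 hp Q S h))) x rfl
  by_contra hnot
  -- If both alternatives fail at `x`, they fail at the end of every segment too, since either could
  -- be carried back by prepending. Hence segments can be concatenated forever, and they visit all
  -- sets `R p`.
  refine hnot (Or.inr (evade_of_segments (W := {x | lab x ∉ X ∧ ¬ out x}) ?_ ⟨hx, hnot⟩))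
  rintro x ⟨hx, hxo⟩ c hc
  have := Fintype.ofFinite V
  rcases exists_segment_forall hN hprep hA hXA
    (L := Finset.univ.filter fun u => ∃ w, 𝒢.El u w) (c := c)
    (fun u hu => by obtain ⟨w, hw⟩ := (Finset.mem_filter.mp hu).2; exact hc u w hw) P
    (fun p hp x hx => exists_segment hN hprep hA (hround p hp) _
      (fun u hu => by obtain ⟨w, hw⟩ := (Finset.mem_filter.mp hu).2; exact hc u w hw) hx) hx with
    h | ⟨l, y, hp, hne, hl, hy, hR, hT⟩
  · exact absurd h hxo
  · exact ⟨l, y, hp, hne, hl, ⟨hy, fun h => hxo (hprep hp hl h)⟩, hR,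
      fun u w hw => hT u (Finset.mem_filter.mpr ⟨Finset.mem_univ _, w, hw⟩)⟩

end Evasion

/-! ### Player 0 does not win outside the fixpoint. -/

section Completeness

variable {V : Type*} {k : ℕ} {𝒢 : LiveGame V} {𝓡 : GenRabin V k}

/-- The only exits are vertices outside `cpre 𝒢 Y`, and one step from there reaches an earlier stage
of the outermost `ν`-variable. By induction along these stages only evasion remains. -/
theorem evade_of_notMem_fixpoint [Finite V] {N : Type*} {nxt : N → N → Prop} {lab : N → V}
    (hN : Unfolds 𝒢 nxt lab) {x : N} (hx : lab x ∉ fixpoint 𝒢 𝓡) :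
    Evade 𝒢 𝓡 nxt lab Set.univ Finset.univ x := by
  rw [fixpoint_eq_levelFix] at hx
  suffices key : ∀ v ∉ levelFix 𝒢 (below 𝒢 𝓡 k Finset.univ Set.univ) (fun _ : Fin 1 => ∅)
      Set.univ ∅, ∀ x : N, lab x = v → Evade 𝒢 𝓡 nxt lab Set.univ Finset.univ x from
    key _ hx x rfl
  refine notMem_nu_induction fun Y hY v hv x hx => ?_
  subst hx
  set f := levelStep 𝒢 (below 𝒢 𝓡 k Finset.univ Set.univ) Set.univ ∅ ∅ Y with hf
  have hg : lab x ∉ mu f := by simpa only [levelBody, Set.iInter_const] using hv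
  rcases escape_or_evade hN (P := Finset.univ) (d := k) (𝓡 := 𝓡) (by simp) (Q := Set.univ)
    (S := enlarge 𝒢 Set.univ ∅ ∅ Y (mu f)) (X := mu f) (D := (cpre 𝒢 Y)ᶜ) (by simp)
    (map_mu (monotone_levelStep (monotone_below 𝒢 𝓡 k _ _) _ _ _ _)).subset
    (fun v h1 h2 => (notMem_enlarge h1 trivial (not_not.mp h2)).2) hg with
    ⟨l, y, hl, _, _, hy⟩ | h
  · obtain ⟨z, hyz, hz⟩ := hN.leave y Y hy
    exact ((hY _ hz z rfl).cons hyz (Set.mem_univ _)).prepend hl fun _ _ => trivial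
  · exact h.mono (Set.subset_univ _) fun p hp => Or.inl hp

/-- One step of a play that is compliant with `ρ`, between nodes that consist of the history and the
current vertex. -/
def HistoryStep (ρ : Strategy 𝒢 𝒢.V0) (x y : List V × V) : Prop :=
  y.1 = x.1 ++ [x.2] ∧ 𝒢.E x.2 y.2 ∧ ∀ h : x.2 ∈ 𝒢.V0, y.2 = ρ.move x.1 ⟨x.2, h⟩

/-- With the history in the node, `ρ` is a function of the node: player 0 nodes have only the
successor that `ρ` chooses, player 1 nodes have all of them. -/
theorem unfolds_historyStep (ρ : Strategy 𝒢 𝒢.V0) :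
    Unfolds 𝒢 (HistoryStep ρ) Prod.snd := by
  refine ⟨fun x X hx => ?_, fun x w hw => ?_⟩
  · by_cases h : x.2 ∈ 𝒢.V0
    · exact ⟨(x.1 ++ [x.2], ρ.move x.1 ⟨x.2, h⟩), ⟨rfl, ρ.legal x.1 ⟨x.2, h⟩, fun _ => rfl⟩,
        fun hX => hx (Or.inl ⟨h, _, ρ.legal x.1 ⟨x.2, h⟩, hX⟩)⟩
    · obtain ⟨w, hw, hwX⟩ : ∃ w, 𝒢.E x.2 w ∧ w ∉ X := by
        by_contra hno
        push Not at hno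
        exact hx (Or.inr ⟨h, hno⟩)
      exact ⟨(x.1 ++ [x.2], w), ⟨rfl, hw, fun h' => absurd h' h⟩, hwX⟩
  · obtain ⟨h0, hE'⟩ := 𝒢.live_edge _ _ hw
    exact ⟨(x.1 ++ [x.2], w), ⟨rfl, hE', fun h => absurd h h0⟩, rfl⟩

theorem history_succ (π : ℕ → V) (i : ℕ) : history π (i + 1) = history π i ++ [π i] := by
  simp [history, List.range_succ]

theorem length_history (π : ℕ → V) (i : ℕ) : (history π i).length = i := by simp [history]

/-- Every infinite path is compliant with some strategy. -/
theorem exists_follows (hE : ∀ v, ∃ w, 𝒢.E v w) (A : Set V) {π : ℕ → V}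
    (hπ : ∀ i, 𝒢.E (π i) (π (i + 1))) : ∃ ρ : Strategy 𝒢 A, Follows ρ π := by
  classical
  choose e he using hE
  refine ⟨⟨fun w v => if π w.length = v then π (w.length + 1) else e v, fun w v => ?_⟩,
    fun i h => ?_⟩
  · split_ifs with h
    · rw [← h]
      exact hπ _
    · exact he v
  · simp [length_history]

theorem winningRegion_subset_fixpoint [Finite V] (hE : ∀ v, ∃ w, 𝒢.E v w) :
    winningRegion 𝒢 (fairAdversarial 𝒢 𝓡.plays) ⊆ fixpoint 𝒢 𝓡 := by
  rintro v ⟨ρ, hρ⟩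
  by_contra hv
  obtain ⟨σ, h0, hσ, -, hfair, hviol⟩ := evade_of_notMem_fixpoint (𝓡 := 𝓡)
    (unfolds_historyStep ρ) (x := (([] : List V), v)) hv
  set π : ℕ → V := fun i => (σ i).2 with hπ
  have hhist (i : ℕ) : (σ i).1 = history π i := by
    induction i with
    | zero => rw [h0]; rfl
    | succ i ih => rw [(hσ i).1, ih, history_succ]
  obtain ⟨ρ₁, hρ₁⟩ := exists_follows hE 𝒢.V0ᶜ (π := π) fun i => (hσ i).2.1
  have hsat := hρ ρ₁ π (by simp [hπ, h0]) (fun i h => by rw [← hhist]; exact (hσ i).2.2 h) hρ₁ hfair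
  obtain ⟨j, hj⟩ := hsat
  exact hviol j (Finset.mem_univ j) hj

end Completeness

/-! ### A finite-memory strategy from the fixpoint -/

section Soundness

variable {V : Type*} {k : ℕ}

section Stages

variable (𝒢 : LiveGame V) (next : Set V → Set V) {m : ℕ} (goal : Fin m → Set V) (Q S : Set V)

/-- The approximants of the `μ`-variable with goal index `g` of a level, for the final value of the
`ν`-variable. -/
def stage (g : Fin m) (r : ℕ) : Set V :=
  (levelStep 𝒢 next Q S (goal g) (levelFix 𝒢 next goal Q S))^[r] ∅

/-- The union of the sets `C` down to a level whose `μ`-variable is at a given stage. -/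
def stageSet (g : Fin m) (r : ℕ) : Set V :=
  enlarge 𝒢 Q S (goal g) (levelFix 𝒢 next goal Q S) (stage 𝒢 next goal Q S g r)

variable {𝒢 next goal Q S}

theorem exists_of_mem_stage {g : Fin m} {r : ℕ} {v : V} (hv : v ∈ stage 𝒢 next goal Q S g r) :
    ∃ r' < r, v ∈ next (stageSet 𝒢 next goal Q S g r') := by
  cases r with
  | zero => exact absurd hv (Set.notMem_empty v)
  | succ r =>
    rw [stage, Function.iterate_succ_apply'] at hv
    exact ⟨r, Nat.lt_succ_self r, hv⟩

/-- The approximants are constant from stage `|V|` on. Stages that serve as ranks can therefore be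
chosen below `|V|`. -/
theorem exists_lt_card_of_mem_stage [Fintype V] (hn : Monotone next) {g : Fin m} {r : ℕ} {v : V}
    (hv : v ∈ stage 𝒢 next goal Q S g r) :
    ∃ r' < r, r' < Fintype.card V ∧ v ∈ next (stageSet 𝒢 next goal Q S g r') := by
  rcases le_total r (Fintype.card V) with h | h
  · obtain ⟨r', hr', hv⟩ := exists_of_mem_stage hv
    exact ⟨r', hr', by omega, hv⟩
  · have hm := monotone_levelStep (𝒢 := 𝒢) hn Q S (goal g) (levelFix 𝒢 next goal Q S)
    have hv := iterate_empty_subset_mu hm r hv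
    rw [mu_eq_iterate hm] at hv
    obtain ⟨r', hr', hv⟩ := exists_of_mem_stage hv
    exact ⟨r', by omega, hr', hv⟩

theorem exists_of_mem_levelFix [Fintype V] (hn : Monotone next) (g : Fin m) {v : V}
    (hv : v ∈ levelFix 𝒢 next goal Q S) :
    ∃ r < Fintype.card V, v ∈ next (stageSet 𝒢 next goal Q S g r) := by
  apply exists_of_mem_stage
  rw [stage, ← mu_eq_iterate (monotone_levelStep hn _ _ _ _)]
  have h : v ∈ levelBody 𝒢 next goal Q S (levelFix 𝒢 next goal Q S) := by
    rwa [levelFix, map_nu (monotone_levelBody hn _ _ _)]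
  exact Set.mem_iInter.mp h g

end Stages

/-! ### Memory states, domains and advice. -/

variable (𝒢 : LiveGame V) (𝓡 : GenRabin V k)

/-- For every pair, the index of the goal set to be visited next. -/
abbrev GenRabin.Mem : Type := (p : Fin k) → Fin (𝓡.m p)

/-- The cyclic successor. -/
def cycle {m : ℕ} (x : Fin m) : Fin m := ⟨(x + 1) % m, Nat.mod_lt _ x.pos⟩

variable {𝓡} in
/-- Turn to the next goal set of the pair `t`. -/
def GenRabin.Mem.bump (t : Option (Fin k)) (l : 𝓡.Mem) : 𝓡.Mem :=
  match t with
  | none => l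
  | some p => Function.update l p (cycle (l p))

variable [Fintype V]

/-- The vertices at which the advice for the levels still to come is available; it only depends on
the value of the levels for the goal indices in the memory. -/
def dom : ℕ → Finset (Fin k) → Set V → Set V → 𝓡.Mem → Set V
  | 0, _, _, S, _ => S
  | d + 1, P, Q, S, l => {v | ∃ (p : Fin k) (r : ℕ), p ∈ P ∧ r < Fintype.card V ∧
      v ∈ dom d (P.erase p) (Q ∩ (𝓡.R p)ᶜ) (stageSet 𝒢
        (below 𝒢 𝓡 d (P.erase p) (Q ∩ (𝓡.R p)ᶜ)) (𝓡.G p) (Q ∩ (𝓡.R p)ᶜ) S (l p) r) l}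

omit [Fintype V] in
theorem exists_least_pair {T : Fin k → ℕ → Prop} (h : ∃ p r, T p r) :
    ∃ x : Fin k × ℕ, T x.1 x.2 ∧ (∀ p r, T p r → x.1 ≤ p) ∧ ∀ r, T x.1 r → x.2 ≤ r := by
  classical
  obtain ⟨p, ⟨r, hr⟩, hp⟩ := WellFounded.has_min (wellFounded_lt (α := Fin k))
    {p | ∃ r, T p r} h
  have hex : ∃ r, T p r := ⟨r, hr⟩
  exact ⟨(p, Nat.find hex), Nat.find_spec hex, fun p' r' h' => not_lt.mp (hp p' ⟨r', h'⟩),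
    fun r' h' => Nat.find_min' hex h'⟩

open Classical in
/-- The advice at one level, given the advice for the levels below: a set which the next vertex should
belong to, and possibly a pair whose goal has been visited. -/
noncomputable def levelAdvice (S G Y X : Set V) (t : Option (Fin k))
    (inner : Option (Set V × Option (Fin k))) (v : V) : Option (Set V × Option (Fin k)) :=
  match inner with
  | some a => some a
  | none =>
    if v ∈ S then none
    else if v ∈ G ∩ cpre 𝒢 Y then some (Y, t)
    else if v ∈ cpre 𝒢 X then some (X, none)
    else some (Y, none)

open Classical in
/-- The advice for the levels still to come; there is none if a move on behalf of the enclosing levels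
is to be made. -/
noncomputable def advice : ℕ → Finset (Fin k) → Set V → Set V → 𝓡.Mem → V →
    Option (Set V × Option (Fin k))
  | 0, _, _, _, _, _ => none
  | d + 1, P, Q, S, l, v =>
    if h : v ∈ dom 𝒢 𝓡 (d + 1) P Q S l then
      let x := (exists_least_pair h).choose
      let Q' := Q ∩ (𝓡.R x.1)ᶜ
      let next := below 𝒢 𝓡 d (P.erase x.1) Q'
      levelAdvice 𝒢 S (𝓡.G x.1 (l x.1)) (levelFix 𝒢 next (𝓡.G x.1) Q' S)
        (stage 𝒢 next (𝓡.G x.1) Q' S (l x.1) x.2) (some x.1)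
        (advice d (P.erase x.1) Q' (stageSet 𝒢 next (𝓡.G x.1) Q' S (l x.1) x.2) l v) v
    else none

variable {𝒢 𝓡}

omit [Fintype V] in
theorem levelAdvice_eq_none {S G Y X : Set V} {t : Option (Fin k)}
    {inner : Option (Set V × Option (Fin k))} {v : V}
    (h : levelAdvice 𝒢 S G Y X t inner v = none) : v ∈ S := by
  rcases inner with _ | a
  · by_contra hv
    simp only [levelAdvice, if_neg hv] at h
    split_ifs at h
  · simp [levelAdvice] at h

omit [Fintype V] in
theorem levelAdvice_cases {Q S G Y X : Set V} {t : Option (Fin k)} {v : V}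
    {a : Set V × Option (Fin k)} (hv : v ∈ enlarge 𝒢 Q S G Y X)
    (h : levelAdvice 𝒢 S G Y X t none v = some a) :
    v ∈ Q ∧ (a = (Y, t) ∧ v ∈ G ∧ v ∈ cpre 𝒢 Y ∨ a = (X, none) ∧ v ∈ cpre 𝒢 X ∨
      a = (Y, none) ∧ v ∈ lpre 𝒢 X ∧ v ∈ cpre 𝒢 Y) := by
  simp only [levelAdvice] at h
  split_ifs at h with h1 h2 h3 <;> cases h
  · exact ⟨(hv.resolve_left h1).1, Or.inl ⟨rfl, h2.1, h2.2⟩⟩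
  · exact ⟨(hv.resolve_left h1).1, Or.inr (Or.inl ⟨rfl, h3⟩)⟩
  · obtain ⟨hQ, h | h | h⟩ := hv.resolve_left h1
    exacts [absurd h h2, absurd h h3, ⟨hQ, Or.inr (Or.inr ⟨rfl, h.1, Or.inr h.2⟩)⟩]

/-- Membership in `below` gives membership in the `μ`-values for all goal indices, whereas `dom`
asks only for the index in the memory. Arrival in `below` is thus safe whatever the memory has
become. -/
theorem below_subset_dom (d : ℕ) (P : Finset (Fin k)) (Q S : Set V) (l : 𝓡.Mem) :
    below 𝒢 𝓡 d P Q S ⊆ dom 𝒢 𝓡 d P Q S l := by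
  induction d generalizing P Q S with
  | zero => exact subset_rfl
  | succ d ih =>
    intro v hv
    obtain ⟨p, hp, hv⟩ := Set.mem_iUnion₂.mp hv
    obtain ⟨r, hr, hv⟩ := exists_of_mem_levelFix (monotone_below 𝒢 𝓡 d _ _) (l p) hv
    exact ⟨p, r, hp, hr, ih _ _ _ hv⟩

theorem mem_of_advice_eq_none {d : ℕ} {P : Finset (Fin k)} {Q S : Set V} {l : 𝓡.Mem} {v : V}
    (hv : v ∈ dom 𝒢 𝓡 d P Q S l) (h : advice 𝒢 𝓡 d P Q S l v = none) : v ∈ S := by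
  cases d with
  | zero => exact hv
  | succ d =>
    simp only [advice, dif_pos hv] at h
    exact levelAdvice_eq_none h

omit [Fintype V] in
theorem GenRabin.Mem.bump_apply_of_ne {t : Option (Fin k)} {p : Fin k} (h : t ≠ some p)
    (l : 𝓡.Mem) : l.bump t p = l p := by
  rcases t with _ | q
  · rfl
  · exact Function.update_of_ne (fun hpq => h (by rw [hpq])) _ _

/-- The pair `p` and the stage `r` support the vertex `v` at the outermost one of the levels still to
come. -/
def Supports (𝒢 : LiveGame V) (𝓡 : GenRabin V k) (d : ℕ) (P : Finset (Fin k)) (Q S : Set V)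
    (l : 𝓡.Mem) (v : V) (p : Fin k) (r : ℕ) : Prop :=
  p ∈ P ∧ r < Fintype.card V ∧ v ∈ dom 𝒢 𝓡 d (P.erase p) (Q ∩ (𝓡.R p)ᶜ) (stageSet 𝒢
    (below 𝒢 𝓡 d (P.erase p) (Q ∩ (𝓡.R p)ᶜ)) (𝓡.G p) (Q ∩ (𝓡.R p)ᶜ) S (l p) r) l

theorem advice_succ {d : ℕ} {P : Finset (Fin k)} {Q S : Set V} {l : 𝓡.Mem} {v : V}
    (hv : v ∈ dom 𝒢 𝓡 (d + 1) P Q S l) : ∃ p r, Supports 𝒢 𝓡 d P Q S l v p r ∧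
      (∀ p' r', Supports 𝒢 𝓡 d P Q S l v p' r' → p ≤ p') ∧
      (∀ r', Supports 𝒢 𝓡 d P Q S l v p r' → r ≤ r') ∧
      advice 𝒢 𝓡 (d + 1) P Q S l v =
        let Q' := Q ∩ (𝓡.R p)ᶜ
        let next := below 𝒢 𝓡 d (P.erase p) Q'
        levelAdvice 𝒢 S (𝓡.G p (l p)) (levelFix 𝒢 next (𝓡.G p) Q' S)
          (stage 𝒢 next (𝓡.G p) Q' S (l p) r) (some p)
          (advice 𝒢 𝓡 d (P.erase p) Q' (stageSet 𝒢 next (𝓡.G p) Q' S (l p) r) l v) v := by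
  obtain ⟨h1, h2, h3⟩ := (exists_least_pair hv).choose_spec
  refine ⟨_, _, h1, h2, h3, ?_⟩
  simp only [advice, dif_pos hv]

/-- The move from `v` to `w` advised at a level on behalf of the pair `p` at stage `r`, with advice
`a`: a move for the levels below, a visit to the goal, a move to an earlier stage, or a move along which
a live edge leads to an earlier stage. -/
inductive LevelMove (𝒢 : LiveGame V) (Y G X : Set V) (p : Fin k)
    (inner : Option (Set V × Option (Fin k))) (v : V) (a : Set V × Option (Fin k)) : Prop
  | inner (h : inner = some a)
  | goal (h : a = (Y, some p)) (hG : v ∈ G)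
  | step (h : a = (X, none))
  | live (h : a = (Y, none)) (hl : v ∈ lpre 𝒢 X)

/-- Advice of the deeper levels can only advance a pair other than `p`. So the goal index of `p`,
and with it the input of the deeper levels, survives such a move; the last conjunct is there for
this reason. -/
theorem advice_sound {d : ℕ} {P : Finset (Fin k)} {Q S : Set V} {l : 𝓡.Mem} {v : V}
    {a : Set V × Option (Fin k)} (hv : v ∈ dom 𝒢 𝓡 d P Q S l)
    (h : advice 𝒢 𝓡 d P Q S l v = some a) :
    v ∈ Q ∧ v ∈ cpre 𝒢 a.1 ∧ (∀ w ∈ a.1, w ∈ dom 𝒢 𝓡 d P Q S (l.bump a.2)) ∧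
      ∀ p, a.2 = some p → p ∈ P := by
  induction d generalizing P Q S with
  | zero => simp [advice] at h
  | succ d ih =>
    obtain ⟨p, r, ⟨hp, hr, hv'⟩, -, -, h'⟩ := advice_succ hv
    rw [h] at h'
    simp only at h'
    have hfix {w : V} (l' : 𝓡.Mem) (hw : w ∈ levelFix 𝒢 (below 𝒢 𝓡 d (P.erase p)
        (Q ∩ (𝓡.R p)ᶜ)) (𝓡.G p) (Q ∩ (𝓡.R p)ᶜ) S) : w ∈ dom 𝒢 𝓡 (d + 1) P Q S l' :=
      below_subset_dom _ _ _ _ _ (levelFix_subset_below 𝒢 𝓡 hp Q S hw)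
    rcases hin : advice 𝒢 𝓡 d (P.erase p) (Q ∩ (𝓡.R p)ᶜ) (stageSet 𝒢 (below 𝒢 𝓡 d (P.erase p)
        (Q ∩ (𝓡.R p)ᶜ)) (𝓡.G p) (Q ∩ (𝓡.R p)ᶜ) S (l p) r) l v with _ | b
    · rw [hin] at h'
      obtain ⟨hQ, ⟨rfl, hG, hc⟩ | ⟨rfl, hc⟩ | ⟨rfl, hl, hc⟩⟩ :=
        levelAdvice_cases (mem_of_advice_eq_none hv' hin) h'.symm
      · exact ⟨hQ.1, hc, fun w hw => hfix _ hw, fun q hq => by cases hq; exact hp⟩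
      · refine ⟨hQ.1, hc, fun w hw => ?_, fun q hq => by cases hq⟩
        obtain ⟨r', hr', hw'⟩ := exists_of_mem_stage hw
        exact ⟨p, r', hp, hr'.trans hr, below_subset_dom _ _ _ _ _ hw'⟩
      · exact ⟨hQ.1, hc, fun w hw => hfix _ hw, fun q hq => by cases hq⟩
    · rw [hin] at h'
      cases h'
      obtain ⟨hQ, hc, hdom, ht⟩ := ih hv' hin
      refine ⟨hQ.1, hc, fun w hw => ⟨p, r, hp, hr, ?_⟩, fun q hq => Finset.mem_of_mem_erase (ht q hq)⟩
      have hne : a.2 ≠ some p := fun h => by simpa using ht p h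
      rw [GenRabin.Mem.bump_apply_of_ne hne]
      exact hdom w hw

end Soundness

/-! ### Fair plays that follow the advice. -/

section Soundness

variable {V : Type*} {k : ℕ} {𝒢 : LiveGame V} {𝓡 : GenRabin V k}

theorem frequently_exists_of_finite {α : Type*} [Finite α] {p : α → ℕ → Prop}
    (h : ∃ᶠ i in atTop, ∃ a, p a i) : ∃ a, ∃ᶠ i in atTop, p a i := by
  by_contra hno
  simp only [not_exists, not_frequently] at hno
  exact h ((eventually_all.mpr hno).mono fun i hi ⟨a, ha⟩ => hi a ha)

/-- The value changes only at times in `T`, so the value reached at one such time is still present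
at the next. If a value occurs there infinitely often, so does its cyclic successor, and by
finiteness some value does. -/
theorem frequently_cycle {m : ℕ} {x : ℕ → Fin m} {T : ℕ → Prop}
    (hT : ∀ᶠ i in atTop, T i → x (i + 1) = cycle (x i))
    (hnT : ∀ᶠ i in atTop, ¬ T i → x (i + 1) = x i) (hf : ∃ᶠ i in atTop, T i) (g : Fin m) :
    ∃ᶠ i in atTop, T i ∧ x i = g := by
  have hsucc (g : Fin m) (hg : ∃ᶠ i in atTop, T i ∧ x i = g) :
      ∃ᶠ i in atTop, T i ∧ x i = cycle g := by
    rw [frequently_atTop]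
    intro b
    obtain ⟨b', hb'⟩ := eventually_atTop.mp (hT.and hnT)
    obtain ⟨i, hi, hTi, hxi⟩ := frequently_atTop.mp hg (max b b')
    have hex : ∃ j, T (i + 1 + j) := by
      obtain ⟨j, hj, hTj⟩ := frequently_atTop.mp hf (i + 1)
      exact ⟨j - (i + 1), by rwa [Nat.add_sub_cancel' hj]⟩
    classical
    have hconst : ∀ j ≤ Nat.find hex, x (i + 1 + j) = cycle g := by
      intro j
      induction j with
      | zero => exact fun _ => by rw [Nat.add_zero, (hb' i (by omega)).1 hTi, hxi]
      | succ j ih =>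
        intro hj
        rw [← ih (by omega), ← add_assoc,
          (hb' (i + 1 + j) (by omega)).2 (Nat.find_min hex (by omega))]
    exact ⟨i + 1 + Nat.find hex, by omega, Nat.find_spec hex, hconst _ le_rfl⟩
  obtain ⟨g₀, hg₀⟩ := frequently_exists_of_finite (p := fun g i => T i ∧ x i = g)
    (hf.mono fun i hi => ⟨x i, hi, rfl⟩)
  have hall (j : ℕ) : ∃ᶠ i in atTop, T i ∧ x i = ⟨(g₀ + j) % m, Nat.mod_lt _ g₀.pos⟩ := by
    induction j with
    | zero => simpa [Nat.mod_eq_of_lt g₀.isLt] using hg₀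
    | succ j ih =>
      refine (hsucc _ ih).mono fun i hi => ⟨hi.1, hi.2.trans (Fin.ext ?_)⟩
      simp [cycle, ← add_assoc]
  -- The natural subtraction is exact because `g₀ < m`; this many cyclic steps lead from `g₀` to
  -- `g`.
  refine (hall (m - g₀ + g)).mono fun i hi => ⟨hi.1, hi.2.trans (Fin.ext ?_)⟩
  have := g₀.isLt
  simp only [show (g₀ : ℕ) + (m - g₀ + g) = g + m by omega, Nat.add_mod_right,
    Nat.mod_eq_of_lt g.isLt]

theorem eventually_const_of_antitone {α : Type*} [LinearOrder α] [WellFoundedLT α] {x : ℕ → α}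
    (h : ∀ᶠ i in atTop, x (i + 1) ≤ x i) : ∃ a, ∀ᶠ i in atTop, x i = a := by
  obtain ⟨b, hb⟩ := eventually_atTop.mp h
  obtain ⟨a, ⟨c, hc⟩, hmin⟩ := WellFounded.has_min (wellFounded_lt (α := α))
    (Set.range fun j => x (b + j)) ⟨_, 0, rfl⟩
  refine ⟨a, eventually_atTop.mpr ⟨b + c, fun i hi => ?_⟩⟩
  induction i, hi using Nat.le_induction with
  | base => exact hc
  | succ i hi ih =>
    refine le_antisymm ((hb i (by omega)).trans_eq ih) (not_lt.mp (hmin _ ⟨i + 1 - b, ?_⟩))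
    simp only
    congr 1
    omega

/-- In a fair play, the rank becomes constant, and no moves that lower it or that are adjacent to a
live edge which lowers it are made any more. -/
theorem eventually_rank_const [Finite V] {π : ℕ → V} (hfair : π ∈ fairPlays 𝒢) (X : ℕ → Set V)
    {ρ : ℕ → ℕ} {N : ℕ} (hN : ∀ᶠ i in atTop, ρ i ≤ N) {I : ℕ → Prop}
    (hlt : ∀ᶠ i in atTop, ∀ s, π (i + 1) ∈ X s → ρ (i + 1) < s)
    (hmove : ∀ᶠ i in atTop, I i ∧ ρ (i + 1) ≤ ρ i ∨ π (i + 1) ∈ X (ρ i) ∨ π i ∈ lpre 𝒢 (X (ρ i))) :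
    ∃ r, ∀ᶠ i in atTop, ρ i = r ∧ I i := by
  classical
  have hex : ∃ r, ∃ᶠ i in atTop, ρ i ≤ r := ⟨N, hN.frequently⟩
  set r := Nat.find hex with hr
  -- `r` is the limit inferior of the rank, finite because the rank is eventually bounded.
  have hge : ∀ᶠ i in atTop, r ≤ ρ i := by
    by_cases h0 : r = 0
    · simp [h0]
    · have := Nat.find_min hex (m := r - 1) (by omega)
      rw [not_frequently] at this
      exact this.mono fun i hi => by omega
  have hle : ∃ᶠ i in atTop, ρ i ≤ r := Nat.find_spec hex
  have hnl : ∀ᶠ i in atTop, ¬ (ρ i = r ∧ π i ∈ lpre 𝒢 (X (ρ i))) := by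
    rw [← not_frequently]
    intro hf
    -- By finiteness one live edge into `X r` is available infinitely often, so fairness takes it
    -- infinitely often. Each time the rank falls below its limit inferior.
    obtain ⟨⟨v, w⟩, hvw⟩ := frequently_exists_of_finite
      (p := fun (e : V × V) i => π i = e.1 ∧ 𝒢.El e.1 e.2 ∧ e.2 ∈ X r)
      (hf.mono fun i ⟨hi, w, hw, hwX⟩ => ⟨(π i, w), rfl, hw, hi ▸ hwX⟩)
    obtain ⟨i, -, hE, hwX⟩ := hvw.exists
    have htaken := hfair v w hE (hvw.mono fun i hi => hi.1)
    obtain ⟨i, ⟨hi, hi'⟩, hg, hl⟩ := (htaken.and_eventually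
      ((eventually_succ.mpr hge).and hlt)).exists
    exact absurd (hl r (hi' ▸ hwX)) (by omega)
  obtain ⟨b, hb⟩ := eventually_atTop.mp (hge.and (hlt.and (hmove.and hnl)))
  obtain ⟨i₀, hi₀, hρ₀⟩ := frequently_atTop.mp hle b
  have step (i : ℕ) (hi : b ≤ i) (hρ : ρ i = r) : ρ (i + 1) = r ∧ I i := by
    obtain ⟨-, h2, h3, h4⟩ := hb i hi
    have h5 := (hb (i + 1) (by omega)).1
    rcases h3 with ⟨h, h'⟩ | h | h
    · exact ⟨by omega, h⟩
    · have := h2 _ h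
      omega
    · exact absurd ⟨hρ, h⟩ h4
  have hconst : ∀ i ≥ i₀, ρ i = r := by
    intro i hi
    induction i, hi using Nat.le_induction with
    | base => exact le_antisymm hρ₀ (hb i₀ hi₀).1
    | succ i hi ih => exact (step i (hi₀.trans hi) ih).1
  exact ⟨r, eventually_atTop.mpr ⟨i₀, fun i hi =>
    ⟨hconst i hi, (step i (hi₀.trans hi) (hconst i hi)).2⟩⟩⟩

variable [Fintype V]

theorem exists_levelMove {d : ℕ} {P : Finset (Fin k)} {Q S : Set V} {l : 𝓡.Mem} {v : V}
    {a : Set V × Option (Fin k)} (hv : v ∈ dom 𝒢 𝓡 (d + 1) P Q S l)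
    (h : advice 𝒢 𝓡 (d + 1) P Q S l v = some a) : ∃ p r, Supports 𝒢 𝓡 d P Q S l v p r ∧
      (∀ p' r', Supports 𝒢 𝓡 d P Q S l v p' r' → p ≤ p') ∧
      (∀ r', Supports 𝒢 𝓡 d P Q S l v p r' → r ≤ r') ∧ v ∉ 𝓡.R p ∧
      let Q' := Q ∩ (𝓡.R p)ᶜ
      let next := below 𝒢 𝓡 d (P.erase p) Q'
      LevelMove 𝒢 (levelFix 𝒢 next (𝓡.G p) Q' S) (𝓡.G p (l p))
        (stage 𝒢 next (𝓡.G p) Q' S (l p) r) p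
        (advice 𝒢 𝓡 d (P.erase p) Q' (stageSet 𝒢 next (𝓡.G p) Q' S (l p) r) l v) v a := by
  obtain ⟨p, r, hs, hp, hr, h'⟩ := advice_succ hv
  rw [h] at h'
  simp only at h'
  refine ⟨p, r, hs, hp, hr, ?_⟩
  have hv' := hs.2.2
  rcases hin : advice 𝒢 𝓡 d (P.erase p) (Q ∩ (𝓡.R p)ᶜ) (stageSet 𝒢 (below 𝒢 𝓡 d (P.erase p)
      (Q ∩ (𝓡.R p)ᶜ)) (𝓡.G p) (Q ∩ (𝓡.R p)ᶜ) S (l p) r) l v with _ | b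
  · rw [hin] at h'
    obtain ⟨hQ, ⟨rfl, hG, -⟩ | ⟨rfl, -⟩ | ⟨rfl, hl, -⟩⟩ :=
      levelAdvice_cases (mem_of_advice_eq_none hv' hin) h'.symm
    exacts [⟨hQ.2, .goal rfl hG⟩, ⟨hQ.2, .step rfl⟩, ⟨hQ.2, .live rfl hl⟩]
  · rw [hin] at h'
    cases h'
    exact ⟨(advice_sound hv' hin).1.2, .inner hin⟩

/-- A fair play that follows the advice satisfies one of the pairs of the levels still to come. -/
theorem exists_satPair_of_advice {π : ℕ → V} {l : ℕ → 𝓡.Mem} (hfair : π ∈ fairPlays 𝒢) {d : ℕ}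
    {P : Finset (Fin k)} {Q S : Set V}
    (h : ∀ᶠ i in atTop, π i ∈ dom 𝒢 𝓡 d P Q S (l i) ∧ ∃ a,
      advice 𝒢 𝓡 d P Q S (l i) (π i) = some a ∧ π (i + 1) ∈ a.1 ∧ l (i + 1) = (l i).bump a.2) :
    ∃ p ∈ P, 𝓡.SatPair p π := by
  induction d generalizing P Q S with
  | zero =>
    obtain ⟨i, -, a, ha, -⟩ := h.exists
    simp [advice] at ha
  | succ d ih =>
    let Q' := fun p => Q ∩ (𝓡.R p)ᶜ
    let next := fun p => below 𝒢 𝓡 d (P.erase p) (Q' p)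
    let Y := fun p => levelFix 𝒢 (next p) (𝓡.G p) (Q' p) S
    let X := fun p => stage 𝒢 (next p) (𝓡.G p) (Q' p) S
    let S' := fun p => stageSet 𝒢 (next p) (𝓡.G p) (Q' p) S
    have h' : ∀ᶠ i in atTop, ∃ p r a, Supports 𝒢 𝓡 d P Q S (l i) (π i) p r ∧
        (∀ p' r', Supports 𝒢 𝓡 d P Q S (l i) (π i) p' r' → p ≤ p') ∧
        (∀ r', Supports 𝒢 𝓡 d P Q S (l i) (π i) p r' → r ≤ r') ∧ π i ∉ 𝓡.R p ∧
        LevelMove 𝒢 (Y p) (𝓡.G p (l i p)) (X p (l i p) r) p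
          (advice 𝒢 𝓡 d (P.erase p) (Q' p) (S' p (l i p) r) (l i) (π i)) (π i) a ∧
        π (i + 1) ∈ a.1 ∧ l (i + 1) = (l i).bump a.2 := by
      filter_upwards [h] with i hi
      obtain ⟨hv, a, ha, hi1, hi2⟩ := hi
      obtain ⟨p, r, h1, h2, h3, h4, h5⟩ := exists_levelMove hv ha
      exact ⟨p, r, a, h1, h2, h3, h4, h5, hi1, hi2⟩
    have : Nonempty (Fin k) := let ⟨_, p, _⟩ := h'.exists; ⟨p⟩
    have hfix {p : Fin k} (hp : p ∈ P) {w : V} (hw : w ∈ Y p) (l' : 𝓡.Mem) :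
        ∃ r, Supports 𝒢 𝓡 d P Q S l' w p r := by
      obtain ⟨r, hr, hw⟩ := exists_of_mem_levelFix (monotone_below 𝒢 𝓡 d _ _) (l' p) hw
      exact ⟨r, hp, hr, below_subset_dom _ _ _ _ _ hw⟩
    have hstage {p : Fin k} (hp : p ∈ P) {w : V} (l' : 𝓡.Mem) {s : ℕ} (hw : w ∈ X p (l' p) s) :
        ∃ r < s, Supports 𝒢 𝓡 d P Q S l' w p r := by
      obtain ⟨r, hrs, hr, hw⟩ := exists_lt_card_of_mem_stage (monotone_below 𝒢 𝓡 d _ _) hw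
      exact ⟨r, hrs, hp, hr, below_subset_dom _ _ _ _ _ hw⟩
    obtain ⟨p, h'⟩ := h'.choice
    obtain ⟨r, h'⟩ := h'.choice
    obtain ⟨a, h'⟩ := h'.choice
    have hinner : ∀ᶠ i in atTop,
        advice 𝒢 𝓡 d (P.erase (p i)) (Q' (p i)) (S' (p i) (l i (p i)) (r i)) (l i) (π i) =
          some (a i) → l (i + 1) (p i) = l i (p i) ∧
            Supports 𝒢 𝓡 d P Q S (l (i + 1)) (π (i + 1)) (p i) (r i) := by
      filter_upwards [h'] with i hi hin
      obtain ⟨⟨hp, hr, hv⟩, -, -, -, -, h1, h2⟩ := hi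
      obtain ⟨-, -, hdom, ht⟩ := advice_sound hv hin
      have hne : (a i).2 ≠ some (p i) := fun h => by simpa using ht _ h
      have hl : l (i + 1) (p i) = l i (p i) := by
        rw [h2, GenRabin.Mem.bump_apply_of_ne hne]
      refine ⟨hl, hp, hr, ?_⟩
      rw [hl, h2]
      exact hdom _ h1
    -- After every kind of move the old pair still supports the new vertex, so the least supporting
    -- pair never increases.
    obtain ⟨q, hq⟩ : ∃ q, ∀ᶠ i in atTop, p i = q := by
      refine eventually_const_of_antitone ?_
      filter_upwards [h', hinner, eventually_succ.mpr h'] with i hi hin hi'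
      obtain ⟨hs, -, -, -, hmove, h1, h2⟩ := hi
      obtain ⟨r', hr'⟩ : ∃ r', Supports 𝒢 𝓡 d P Q S (l (i + 1)) (π (i + 1)) (p i) r' := by
        rcases hmove with h | ⟨h, -⟩ | h | ⟨h, -⟩
        · exact ⟨_, (hin h).2⟩
        · rw [h] at h1
          exact hfix hs.1 h1 _
        · rw [h] at h1 h2
          obtain ⟨r', -, hr'⟩ := hstage hs.1 (l (i + 1)) (by rw [h2]; exact h1)
          exact ⟨r', hr'⟩
        · rw [h] at h1
          exact hfix hs.1 h1 _
      exact hi'.2.1 _ _ hr'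
    have hqP : q ∈ P := by
      obtain ⟨i, hi, hi'⟩ := (h'.and hq).exists
      exact hi' ▸ hi.1.1
    -- `T` marks the times at which the goal of `q` is credited and its index advances.
    let T : ℕ → Prop := fun i => a i = (Y q, some q) ∧ π i ∈ 𝓡.G q (l i q)
    by_cases hT : ∃ᶠ i in atTop, T i
    · refine ⟨q, hqP, ?_, fun g => ?_⟩
      · filter_upwards [h', hq] with i hi hiq
        exact hiq ▸ hi.2.2.2.1
      · refine (frequently_cycle (x := fun i => l i q) ?_ ?_ hT g).mono
          fun i ⟨hi, hg⟩ => hg ▸ hi.2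
        · filter_upwards [h'] with i hi hTi
          rw [hi.2.2.2.2.2.2, hTi.1]
          exact Function.update_self _ _ _
        · filter_upwards [h', hinner, hq] with i hi hin hiq hTi
          subst hiq
          obtain ⟨-, -, -, -, hmove, -, h2⟩ := hi
          rcases hmove with h | ⟨h, hG⟩ | h | ⟨h, -⟩
          · exact (hin h).1
          · exact absurd ⟨h, hG⟩ hTi
          · rw [h2, h]; rfl
          · rw [h2, h]; rfl
    · rw [not_frequently] at hT
      -- All moves other than goal moves of `q` leave its index unchanged.
      obtain ⟨g, hg⟩ : ∃ g, ∀ᶠ i in atTop, l i q = g := by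
        refine eventually_const_of_antitone ?_
        filter_upwards [h', hinner, hq, hT] with i hi hin hiq hTi
        subst hiq
        obtain ⟨-, -, -, -, hmove, -, h2⟩ := hi
        rcases hmove with h | ⟨h, hG⟩ | h | ⟨h, -⟩
        · exact (hin h).1.le
        · exact absurd ⟨h, hG⟩ hTi
        · rw [h2, h]; rfl
        · rw [h2, h]; rfl
      -- The rank is the least supporting stage. Inner moves do not raise it, and the two remaining
      -- kinds of move head for an earlier stage directly or along a live edge.
      obtain ⟨s, hs⟩ := eventually_rank_const hfair (X q g) (ρ := r) (N := Fintype.card V)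
        (I := fun i => advice 𝒢 𝓡 d (P.erase q) (Q' q) (S' q g (r i)) (l i) (π i) = some (a i))
        (h'.mono fun i hi => hi.1.2.1.le)
        (by
          filter_upwards [eventually_succ.mpr h', eventually_succ.mpr hq,
            eventually_succ.mpr hg] with i hi hiq hig s hw
          obtain ⟨r', hrs, hr'⟩ := hstage hqP (l (i + 1)) (by rw [hig]; exact hw)
          exact (hi.2.2.1 r' (hiq ▸ hr')).trans_lt hrs)
        (by
          filter_upwards [h', hinner, hq, hg, hT, eventually_succ.mpr h',
            eventually_succ.mpr hq] with i hi hin hiq hig hTi hi' hiq'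
          subst hiq
          subst hig
          obtain ⟨-, -, -, -, hmove, h1, -⟩ := hi
          rcases hmove with h | ⟨h, hG⟩ | h | ⟨h, hl⟩
          · exact Or.inl ⟨h, hi'.2.2.1 _ (hiq'.symm ▸ (hin h).2)⟩
          · exact absurd ⟨h, hG⟩ hTi
          · rw [h] at h1
            exact Or.inr (Or.inl h1)
          · exact Or.inr (Or.inr hl))
      -- With pair, goal index and stage fixed and only inner moves left, the play follows the
      -- advice of the deeper levels for one fixed input.
      obtain ⟨q', hq', hsat⟩ := ih (P := P.erase q) (Q := Q' q) (S := S' q g s) (by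
        filter_upwards [h', hs, hq, hg] with i hi his hiq hig
        obtain ⟨rfl, hin⟩ := his
        subst hiq
        subst hig
        exact ⟨hi.1.2.2, a i, hin, hi.2.2.2.2.2⟩)
      exact ⟨q', Finset.mem_of_mem_erase hq', hsat⟩

end Soundness

/-! ### The outermost level and the finite-memory strategy. -/

section Soundness

variable {V : Type*} [Fintype V] {k : ℕ} (𝒢 : LiveGame V) (𝓡 : GenRabin V k)

/-- The approximants of the outermost `μ`-variable. -/
def topStage (r : ℕ) : Set V :=
  stage 𝒢 (below 𝒢 𝓡 k Finset.univ Set.univ) (fun _ : Fin 1 => ∅) Set.univ ∅ 0 r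

/-- The set `C` of the outermost level. -/
def topSet (r : ℕ) : Set V :=
  stageSet 𝒢 (below 𝒢 𝓡 k Finset.univ Set.univ) (fun _ : Fin 1 => ∅) Set.univ ∅ 0 r

/-- The stage `r` supports the vertex `v` at the outermost level. -/
def TopSupports (l : 𝓡.Mem) (v : V) (r : ℕ) : Prop :=
  r < Fintype.card V ∧ v ∈ dom 𝒢 𝓡 k Finset.univ Set.univ (topSet 𝒢 𝓡 r) l

open Classical in
/-- The advice for the whole expression. -/
noncomputable def topAdvice (l : 𝓡.Mem) (v : V) : Option (Set V × Option (Fin k)) :=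
  if h : ∃ r, TopSupports 𝒢 𝓡 l v r then
    levelAdvice 𝒢 ∅ ∅ (fixpoint 𝒢 𝓡) (topStage 𝒢 𝓡 (Nat.find h)) none
      (advice 𝒢 𝓡 k Finset.univ Set.univ (topSet 𝒢 𝓡 (Nat.find h)) l v) v
  else none

variable {𝒢 𝓡}

theorem topSupports_of_mem_fixpoint (l : 𝓡.Mem) {v : V} (hv : v ∈ fixpoint 𝒢 𝓡) :
    ∃ r, TopSupports 𝒢 𝓡 l v r := by
  rw [fixpoint_eq_levelFix] at hv
  obtain ⟨r, hr, hv⟩ := exists_of_mem_levelFix (monotone_below 𝒢 𝓡 k _ _) 0 hv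
  exact ⟨r, hr, below_subset_dom _ _ _ _ _ hv⟩

theorem topSupports_of_mem_topStage (l : 𝓡.Mem) {v : V} {s : ℕ} (hv : v ∈ topStage 𝒢 𝓡 s) :
    ∃ r < s, TopSupports 𝒢 𝓡 l v r := by
  obtain ⟨r, hrs, hr, hw⟩ := exists_lt_card_of_mem_stage (monotone_below 𝒢 𝓡 k _ _) hv
  exact ⟨r, hrs, hr, below_subset_dom _ _ _ _ _ hw⟩

/-- The artificial pair has no memory component, and its empty goal set rules out goal moves. Only
inner moves and moves towards an earlier stage occur. -/
theorem topAdvice_sound {l : 𝓡.Mem} {v : V} (hv : ∃ r, TopSupports 𝒢 𝓡 l v r) :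
    ∃ r a, TopSupports 𝒢 𝓡 l v r ∧ (∀ r', TopSupports 𝒢 𝓡 l v r' → r ≤ r') ∧
      topAdvice 𝒢 𝓡 l v = some a ∧ v ∈ cpre 𝒢 a.1 ∧
      (∀ w ∈ a.1, ∃ r', TopSupports 𝒢 𝓡 (l.bump a.2) w r') ∧
      (advice 𝒢 𝓡 k Finset.univ Set.univ (topSet 𝒢 𝓡 r) l v = some a ∧
          (∀ w ∈ a.1, TopSupports 𝒢 𝓡 (l.bump a.2) w r) ∨
        a.1 = topStage 𝒢 𝓡 r ∨ v ∈ lpre 𝒢 (topStage 𝒢 𝓡 r)) := by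
  classical
  have hs := Nat.find_spec hv
  set r := Nat.find hv with hr
  have heq : topAdvice 𝒢 𝓡 l v = levelAdvice 𝒢 ∅ ∅ (fixpoint 𝒢 𝓡) (topStage 𝒢 𝓡 r) none
      (advice 𝒢 𝓡 k Finset.univ Set.univ (topSet 𝒢 𝓡 r) l v) v := by
    rw [topAdvice, dif_pos hv, hr]
  rcases hadv : topAdvice 𝒢 𝓡 l v with _ | a
  · rw [hadv] at heq
    exact absurd (levelAdvice_eq_none heq.symm) (Set.notMem_empty v)
  rw [hadv] at heq
  refine ⟨r, a, hs, fun r' h' => Nat.find_min' hv h', rfl, ?_⟩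
  rcases hin : advice 𝒢 𝓡 k Finset.univ Set.univ (topSet 𝒢 𝓡 r) l v with _ | b
  · rw [hin] at heq
    have hmem : v ∈ enlarge 𝒢 Set.univ ∅ ∅ (fixpoint 𝒢 𝓡) (topStage 𝒢 𝓡 r) := by
      rw [fixpoint_eq_levelFix]
      exact mem_of_advice_eq_none hs.2 hin
    obtain ⟨-, ⟨-, hG, -⟩ | ⟨rfl, hc⟩ | ⟨rfl, hl, hc⟩⟩ := levelAdvice_cases hmem heq.symm
    · exact absurd hG (Set.notMem_empty v)
    · exact ⟨hc, fun w hw => let ⟨r', _, h⟩ := topSupports_of_mem_topStage _ hw; ⟨r', h⟩,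
        Or.inr (Or.inl rfl)⟩
    · exact ⟨hc, fun w hw => topSupports_of_mem_fixpoint _ hw, Or.inr (Or.inr hl)⟩
  · rw [hin] at heq
    cases heq
    obtain ⟨-, hc, hdom, -⟩ := advice_sound hs.2 hin
    exact ⟨hc, fun w hw => ⟨r, hs.1, hdom w hw⟩, Or.inl ⟨rfl, fun w hw => ⟨hs.1, hdom w hw⟩⟩⟩

/-- The memory update of the strategy. -/
noncomputable def memUpdate (l : 𝓡.Mem) (v : V) : 𝓡.Mem :=
  match topAdvice 𝒢 𝓡 l v with
  | none => l
  | some a => l.bump a.2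

/-- A play on which the advice for the whole expression is followed. -/
theorem mem_plays_of_topAdvice {π : ℕ → V} {l : ℕ → 𝓡.Mem} (hfair : π ∈ fairPlays 𝒢)
    (hl : ∀ i, l (i + 1) = memUpdate (𝒢 := 𝒢) (l i) (π i))
    (hsup : ∀ i, ∃ r, TopSupports 𝒢 𝓡 (l i) (π i) r)
    (hπ : ∀ i a, topAdvice 𝒢 𝓡 (l i) (π i) = some a → π (i + 1) ∈ a.1) : π ∈ 𝓡.plays := by
  choose ρ a h1 h2 h3 h4 h5 h6 using fun i => topAdvice_sound (hsup i)
  have hl' (i) : l (i + 1) = (l i).bump (a i).2 := by rw [hl, memUpdate, h3]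
  obtain ⟨r, hr⟩ := eventually_rank_const hfair (topStage 𝒢 𝓡) (ρ := ρ) (N := Fintype.card V)
    (I := fun i => advice 𝒢 𝓡 k Finset.univ Set.univ (topSet 𝒢 𝓡 (ρ i)) (l i) (π i) = some (a i))
    (.of_forall fun i => (h1 i).1.le)
    (.of_forall fun i s hs => by
      obtain ⟨r, hr, h⟩ := topSupports_of_mem_topStage (l (i + 1)) hs
      exact (h2 _ _ h).trans_lt hr)
    (.of_forall fun i => by
      have hi := hπ i _ (h3 i)
      rcases h6 i with ⟨h, h'⟩ | h | h
      · exact Or.inl ⟨h, h2 _ _ (by rw [hl']; exact h' _ hi)⟩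
      · exact Or.inr (Or.inl (h ▸ hi))
      · exact Or.inr (Or.inr h))
  obtain ⟨p, -, hp⟩ := exists_satPair_of_advice hfair (l := l) (P := Finset.univ) (Q := Set.univ)
    (S := topSet 𝒢 𝓡 r) (hr.mono fun i ⟨hi, hin⟩ =>
      ⟨hi ▸ (h1 i).2, a i, hi ▸ hin, hπ i _ (h3 i), hl' i⟩)
  exact ⟨p, hp⟩

theorem exists_finiteMemory_winning (hE : ∀ v, ∃ w, 𝒢.E v w) (hm : ∀ j, 1 ≤ 𝓡.m j) :
    ∃ ρ₀ : Strategy 𝒢 𝒢.V0, FiniteMemory ρ₀ ∧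
      ∀ v ∈ fixpoint 𝒢 𝓡, WinsFrom ρ₀ (fairAdversarial 𝒢 𝓡.plays) v := by
  classical
  let init : 𝓡.Mem := fun p => ⟨0, hm p⟩
  -- Where the advice cannot be realized, an arbitrary successor is the default. Plays from the
  -- fixpoint never meet this case.
  have hout (l : 𝓡.Mem) (v : 𝒢.V0) : ∃ w, 𝒢.E v w ∧ ∀ a, topAdvice 𝒢 𝓡 l v = some a →
      (v : V) ∈ cpre 𝒢 a.1 → w ∈ a.1 := by
    by_cases h : ∃ a, topAdvice 𝒢 𝓡 l v = some a ∧ (v : V) ∈ cpre 𝒢 a.1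
    · obtain ⟨a, ha, ⟨-, w, hw, hwa⟩ | ⟨hv, -⟩⟩ := h
      · refine ⟨w, hw, fun b hb _ => ?_⟩
        rw [ha] at hb
        cases hb
        exact hwa
      · exact absurd v.2 hv
    · push Not at h
      obtain ⟨w, hw⟩ := hE v
      exact ⟨w, hw, fun a ha hc => absurd hc (h a ha)⟩
  choose out hout1 hout2 using hout
  refine ⟨⟨fun w v => out (w.foldl (memUpdate (𝒢 := 𝒢)) init) v, fun w v => hout1 _ v⟩,
    ⟨𝓡.Mem, inferInstance, init, memUpdate (𝒢 := 𝒢), out, fun w v => rfl⟩, ?_⟩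
  intro v hv ρ₁ π h0 hρ₀ hρ₁ hfair
  let l : ℕ → 𝓡.Mem := fun i => (history π i).foldl (memUpdate (𝒢 := 𝒢)) init
  have hl (i) : l (i + 1) = memUpdate (𝒢 := 𝒢) (l i) (π i) := by
    simp only [l, history_succ, List.foldl_append, List.foldl_cons, List.foldl_nil]
  have hstep (i) (a) (ha : topAdvice 𝒢 𝓡 (l i) (π i) = some a) (hc : π i ∈ cpre 𝒢 a.1) :
      π (i + 1) ∈ a.1 := by
    by_cases hi : π i ∈ 𝒢.V0
    · rw [hρ₀ i hi]
      exact hout2 _ ⟨π i, hi⟩ a ha hc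
    · rcases hc with hc | hc
      · exact absurd hc.1 hi
      · have := hρ₁ i hi
        exact hc.2 _ (this ▸ ρ₁.legal _ ⟨π i, hi⟩)
  have hadv (i) (h : ∃ r, TopSupports 𝒢 𝓡 (l i) (π i) r) : ∃ a,
      topAdvice 𝒢 𝓡 (l i) (π i) = some a ∧ π (i + 1) ∈ a.1 ∧
        ∃ r, TopSupports 𝒢 𝓡 (l (i + 1)) (π (i + 1)) r := by
    obtain ⟨r, a, -, -, ha, hc, hs, -⟩ := topAdvice_sound h
    have hi := hstep i a ha hc
    refine ⟨a, ha, hi, ?_⟩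
    rw [hl, memUpdate, ha]
    exact hs _ hi
  have hsup (i) : ∃ r, TopSupports 𝒢 𝓡 (l i) (π i) r := by
    induction i with
    | zero => exact topSupports_of_mem_fixpoint _ (h0 ▸ hv)
    | succ i ih => exact let ⟨_, _, _, h⟩ := hadv i ih; h
  refine mem_plays_of_topAdvice hfair hl hsup fun i a ha => ?_
  obtain ⟨b, hb, hi, -⟩ := hadv i (hsup i)
  rw [ha] at hb
  cases hb
  exact hi

theorem fixpoint_eq_winningRegion (hE : ∀ v, ∃ w, 𝒢.E v w) (hm : ∀ j, 1 ≤ 𝓡.m j) :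
    fixpoint 𝒢 𝓡 = winningRegion 𝒢 (fairAdversarial 𝒢 𝓡.plays) := by
  refine Set.Subset.antisymm (fun v hv => ?_) (winningRegion_subset_fixpoint hE)
  obtain ⟨ρ, -, hρ⟩ := exists_finiteMemory_winning (𝓡 := 𝓡) hE hm
  exact ⟨ρ, hρ v hv⟩

end Soundness

/-! ### Muller conditions as generalized Rabin conditions. -/

section Muller

variable {V : Type*} [Finite V] {k : ℕ}

theorem plays_ofMuller (F : Fin k → Finset V) : (GenRabin.ofMuller F).plays = mullerPlays F := by
  ext π
  refine exists_congr fun j => ⟨fun ⟨h1, h2⟩ => ?_, fun h => ⟨?_, fun l => ?_⟩⟩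
  · ext v
    refine ⟨fun hv => ?_, fun hv => ?_⟩
    · obtain ⟨i, hi, hi'⟩ := (Filter.Frequently.and_eventually hv h1).exists
      exact hi ▸ not_not.mp hi'
    · have h := h2 ((F j).equivFin ⟨v, hv⟩)
      refine Filter.Frequently.mono h fun i hi => ?_
      rw [show π i = _ from hi, Equiv.symm_apply_apply]
  · have : ∀ᶠ i in atTop, ∀ v : V, v ∉ F j → π i ≠ v := by
      refine eventually_all.mpr fun v => ?_
      by_cases hv : v ∈ F j
      · exact .of_forall fun i h => absurd hv h
      · have h' : v ∉ {v | ∃ᶠ i in atTop, π i = v} := fun h' => hv (by rw [h] at h'; exact h')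
        exact (not_frequently.mp h').mono fun i hi _ => hi
    exact this.mono fun i hi hiF => hi _ hiF rfl
  · have : (((F j).equivFin.symm l : F j) : V) ∈ {v | ∃ᶠ i in atTop, π i = v} := by
      rw [h]
      exact ((F j).equivFin.symm l).2
    exact this

end Muller

/-! ### The fixpoint algorithm -/

namespace Sym

variable {V : Type*}

/-- The table of a symbolic computation. -/
abbrev Table (V : Type*) := List ℕ → Option (Set V × Set V)

/-- Started in a state that satisfies `inv`, the computation `x` returns `val`, preserves `inv`, changes
the table only in `region`, and makes at most `c` steps that are not paid for by `pot`. -/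
def Runs (x : Sym V (Set V)) (val : Set V) (inv : Table V → Prop) (pot : Table V → ℕ)
    (region : Set (List ℕ)) (c : ℕ) : Prop :=
  ∀ s : SymState V, inv s.table → (x s).1 = val ∧ inv (x s).2.table ∧
    (∀ κ ∉ region, (x s).2.table κ = s.table κ) ∧
    (x s).2.steps + pot (x s).2.table ≤ s.steps + pot s.table + c

/-- `f` depends on the part of the table in `region` only. -/
def DependsOn {α : Type*} (f : Table V → α) (region : Set (List ℕ)) : Prop :=
  ∀ t t' : Table V, (∀ κ ∈ region, t κ = t' κ) → f t = f t'

/-- Combine the results of a list of computations. -/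
def foldAll (op : Set V → Set V → Set V) (e : Set V) : List (Sym V (Set V)) → Sym V (Set V)
  | [] => ret e
  | x :: xs => bind x fun A => bind (foldAll op e xs) fun B => tick (op A B)

theorem unionAll_eq (xs : List (Sym V (Set V))) : unionAll xs = foldAll (· ∪ ·) ∅ xs := by
  induction xs with
  | nil => rfl
  | cons x xs ih => rw [unionAll, ih]; rfl

theorem interAll_eq (xs : List (Sym V (Set V))) : interAll xs = foldAll (· ∩ ·) Set.univ xs := by
  induction xs with
  | nil => rfl
  | cons x xs ih => rw [interAll, ih]; rfl

theorem foldr_union_eq {ι : Type*} (xs : List ι) (val : ι → Set V) :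
    (xs.map val).foldr (· ∪ ·) ∅ = ⋃ l ∈ xs, val l := by
  induction xs with
  | nil => simp
  | cons x xs ih => simp only [List.map_cons, List.foldr_cons, ih, List.mem_cons,
      Set.iUnion_iUnion_eq_or_left]

theorem foldr_inter_eq {ι : Type*} (xs : List ι) (val : ι → Set V) :
    (xs.map val).foldr (· ∩ ·) Set.univ = ⋂ l ∈ xs, val l := by
  induction xs with
  | nil => simp
  | cons x xs ih => simp only [List.map_cons, List.foldr_cons, ih, List.mem_cons,
      Set.iInter_iInter_eq_or_left]

theorem sum_map_congr {ι : Type*} {xs : List ι} {f g : ι → ℕ} (h : ∀ l ∈ xs, f l = g l) :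
    (xs.map f).sum = (xs.map g).sum := by
  rw [List.map_congr_left h]

/-- Disjoint regions make the computations independent: each preserves the invariants and potentials
of the others. The extra step per item is the application of `op`. -/
theorem runs_foldAll (op : Set V → Set V → Set V) (e : Set V) {ι : Type*} {xs : List ι}
    (hxs : xs.Nodup) {x : ι → Sym V (Set V)} {val : ι → Set V} {inv : ι → Table V → Prop}
    {pot : ι → Table V → ℕ} {region : ι → Set (List ℕ)} {c : ℕ}
    (hx : ∀ l ∈ xs, Runs (x l) (val l) (inv l) (pot l) (region l) c)
    (hinv : ∀ l ∈ xs, DependsOn (inv l) (region l))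
    (hpot : ∀ l ∈ xs, DependsOn (pot l) (region l))
    (hdisj : ∀ l l' κ, κ ∈ region l → κ ∈ region l' → l = l') :
    Runs (foldAll op e (xs.map x)) ((xs.map val).foldr op e) (fun t => ∀ l ∈ xs, inv l t)
      (fun t => (xs.map fun l => pot l t).sum) {κ | ∃ l ∈ xs, κ ∈ region l}
      (xs.length * (c + 1)) := by
  induction xs with
  | nil =>
    intro s hs
    exact ⟨rfl, hs, fun _ _ => rfl, by simp [foldAll, ret]⟩
  | cons l xs ih =>
    intro s hs
    obtain ⟨hl, hxs⟩ := List.nodup_cons.mp hxs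
    obtain ⟨h1, h2, h3, h4⟩ := hx l (by simp) s (hs l (by simp))
    set s₁ := (x l s).2 with hs₁
    have hagree : ∀ l' ∈ xs, ∀ κ ∈ region l', s.table κ = s₁.table κ := fun l' hl' κ hκ =>
      (h3 κ fun hκ' => hl (hdisj l l' κ hκ' hκ ▸ hl')).symm
    obtain ⟨g1, g2, g3, g4⟩ := ih hxs (fun l' hl' => hx l' (List.mem_cons_of_mem _ hl'))
      (fun l' hl' => hinv l' (List.mem_cons_of_mem _ hl'))
      (fun l' hl' => hpot l' (List.mem_cons_of_mem _ hl')) s₁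
      fun l' hl' => (hinv l' (List.mem_cons_of_mem _ hl') _ _ (hagree l' hl')) ▸ hs l' (List.mem_cons_of_mem _ hl')
    set s₂ := (foldAll op e (xs.map x) s₁).2 with hs₂
    have heq : foldAll op e ((l :: xs).map x) s =
        (op (x l s).1 (foldAll op e (xs.map x) s₁).1, { s₂ with steps := s₂.steps + 1 }) := rfl
    have hagree' : ∀ κ ∈ region l, s₁.table κ = s₂.table κ := fun κ hκ =>
      (g3 κ fun ⟨l', hl', hκ'⟩ => hl (hdisj l l' κ hκ hκ' ▸ hl')).symm
    rw [heq]
    refine ⟨by simp only [h1, g1, List.map_cons, List.foldr_cons], ?_, fun κ hκ => ?_, ?_⟩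
    · intro l' hl'
      rcases List.mem_cons.mp hl' with rfl | hl'
      · exact (hinv _ (by simp) _ _ hagree') ▸ h2
      · exact g2 l' hl'
    · exact (g3 κ fun ⟨l', hl', h⟩ => hκ ⟨l', List.mem_cons_of_mem _ hl', h⟩).trans
        (h3 κ fun h => hκ ⟨l, by simp, h⟩)
    · have e1 : (xs.map fun l => pot l s.table).sum = (xs.map fun l => pot l s₁.table).sum :=
        sum_map_congr fun l' hl' => hpot l' (List.mem_cons_of_mem _ hl') _ _ (hagree l' hl')
      have e2 : pot l s₁.table = pot l s₂.table := hpot l (by simp) _ _ hagree'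
      simp only [List.map_cons, List.sum_cons, List.length_cons, add_mul, one_mul]
      simp only [← e1] at g4
      omega

/-- Keys that extend `key`. -/
def cone (key : List ℕ) : Set (List ℕ) := {κ | key <+: κ}

theorem cone_append_subset (key u : List ℕ) : cone (key ++ u) ⊆ cone key :=
  fun _ h => (List.prefix_append key u).trans h

/-- Different suffixes of equal length have disjoint cones; this separates the table entries of
different goals, rounds and pairs. -/
theorem eq_of_mem_cone_append {key u u' κ : List ℕ} (hu : u.length = u'.length)
    (h : κ ∈ cone (key ++ u)) (h' : κ ∈ cone (key ++ u')) : u = u' := by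
  obtain ⟨w, rfl⟩ := h
  obtain ⟨w', h'⟩ := h'
  rw [List.append_assoc, List.append_assoc] at h'
  exact (List.append_inj (List.append_cancel_left h') hu.symm).1.symm

theorem notMem_cone_append {key u : List ℕ} (hu : u ≠ []) : key ∉ cone (key ++ u) := by
  rintro ⟨w, hw⟩
  rw [List.append_assoc] at hw
  have := List.append_right_eq_self.mp hw
  simp at this
  exact hu this.1

theorem DependsOn.mono {α : Type*} {f : Table V → α} {r r' : Set (List ℕ)} (h : DependsOn f r)
    (hr : r ⊆ r') : DependsOn f r' :=
  fun t t' ht => h t t' fun κ hκ => ht κ (hr hκ)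

/-- What is needed of the evaluator `ev` of the levels below some level: it computes `next`, and
`inv key S` says that the table is ready for an evaluation under `key` with an input below `S`. -/
structure Evaluates (ev : List ℕ → Set V → Sym V (Set V)) (next : Set V → Set V)
    (inv : List ℕ → Set V → Table V → Prop) (pot : List ℕ → Table V → ℕ) (c : ℕ) : Prop where
  mono : Monotone next
  inv_anti : ∀ {key S T t}, S ⊆ T → inv key T t → inv key S t
  inv_dep : ∀ key S, DependsOn (inv key S) (cone key)
  pot_dep : ∀ key, DependsOn (pot key) (cone key)
  runs : ∀ key S, Runs (ev key S) (next S) (inv key S) (pot key) (cone key) c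

theorem sum_range_add_eq {n i : ℕ} (hi : i < n) {f g : ℕ → ℕ} (h : ∀ j, j ≠ i → f j = g j) :
    ∑ j ∈ Finset.range n, f j + g i = ∑ j ∈ Finset.range n, g j + f i := by
  have hi := Finset.mem_range.mpr hi
  have e : ∑ j ∈ (Finset.range n).erase i, f j = ∑ j ∈ (Finset.range n).erase i, g j :=
    Finset.sum_congr rfl fun j hj => h j (Finset.ne_of_mem_erase hj)
  have e1 := Finset.add_sum_erase _ f hi
  have e2 := Finset.add_sum_erase _ g hi
  linarith

/-! ### Iterations for `μ`-variables and the body of a level. -/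

section Level

variable {𝒢 : LiveGame V} {ev : List ℕ → Set V → Sym V (Set V)} {next : Set V → Set V}
  {inv : List ℕ → Set V → Table V → Prop} {pot : List ℕ → Table V → ℕ} {c : ℕ}

/-- One round of the iteration for a `μ`-variable. -/
def muRound (𝒢 : LiveGame V) (ev : List ℕ → Set V → Sym V (Set V)) (key : List ℕ)
    (Q S G Y : Set V) (l i : ℕ) (X : Set V) : Sym V (Set V) :=
  bind (sCpre 𝒢 Y) fun A₁ => bind (sInter G A₁) fun A₂ =>
  bind (sApre 𝒢 Y X) fun A₃ => bind (sUnion A₂ A₃) fun A₄ =>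
  bind (sInter Q A₄) fun C => bind (sUnion S C) fun S' => ev (key ++ [l, i]) S'

theorem muRound_apply (key : List ℕ) (Q S G Y : Set V) (l i : ℕ) (X : Set V) (s : SymState V) :
    muRound 𝒢 ev key Q S G Y l i X s =
      ev (key ++ [l, i]) (enlarge 𝒢 Q S G Y X) ⟨s.steps + 6, s.table⟩ := rfl

/-- The table is ready for all rounds of the iteration for a `μ`-variable. -/
def muInv (𝒢 : LiveGame V) (next : Set V → Set V) (inv : List ℕ → Set V → Table V → Prop)
    (key : List ℕ) (Q S G Y : Set V) (l : ℕ) (t : Table V) : Prop :=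
  ∀ j, inv (key ++ [l, j]) (enlarge 𝒢 Q S G Y ((levelStep 𝒢 next Q S G Y)^[j] ∅)) t

/-- Restarting a `μ`-iteration from `∅` with smaller enclosing sets gives smaller inputs at every
counter. Entries left by earlier evaluations thus remain usable. -/
theorem muInv_anti (h : Evaluates ev next inv pot c) {key : List ℕ} {Q S S' G Y Y' : Set V}
    {l : ℕ} {t : Table V} (hS : S' ⊆ S) (hY : Y' ⊆ Y)
    (ht : muInv 𝒢 next inv key Q S G Y l t) : muInv 𝒢 next inv key Q S' G Y' l t :=
  fun j => h.inv_anti (enlarge_mono 𝒢 Q G hS hY (iterate_empty_mono_left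
    (monotone_levelStep h.mono _ _ _ _)
    (fun _ => levelStep_mono h.mono _ _ hS hY subset_rfl) j)) (ht j)

theorem bind_sEq_pos {α : Type*} {A B : Set V} (h : A = B) (f : Bool → Sym V α)
    (s : SymState V) : bind (sEq A B) f s = f true ⟨s.steps + 1, s.table⟩ := by
  classical
  rw [← decide_eq_true h]
  rfl

theorem bind_sEq_neg {α : Type*} {A B : Set V} (h : A ≠ B) (f : Bool → Sym V α)
    (s : SymState V) : bind (sEq A B) f s = f false ⟨s.steps + 1, s.table⟩ := by
  classical
  rw [← decide_eq_false h]
  rfl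

theorem bind_fetch {α : Type*} {key : List ℕ} {s : SymState V} {o : Option (Set V × Set V)}
    (h : s.table key = o) (f : Option (Set V × Set V) → Sym V α) :
    bind (fetch key) f s = f o s := by
  rw [← h]
  rfl

open Classical in
theorem iter_succ (f : ℕ → Set V → Sym V (Set V)) (fuel i : ℕ) (X : Set V) (s : SymState V) :
    iter f (fuel + 1) i X s =
      if (f i X s).1 = X then (X, ⟨(f i X s).2.steps + 1, (f i X s).2.table⟩)
      else iter f fuel (i + 1) (f i X s).1 ⟨(f i X s).2.steps + 1, (f i X s).2.table⟩ := by
  change bind (sEq (f i X s).1 X) (fun b => if b then ret X else iter f fuel (i + 1) (f i X s).1)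
    (f i X s).2 = _
  split_ifs with h
  · exact bind_sEq_pos h _ _
  · exact bind_sEq_neg h _ _

/-- Each round costs six set operations, one equality test and `c` for the deeper levels. Round `i`
changes only entries in its own cone, so it draws on its own summand of the potential. -/
theorem iter_mu (h : Evaluates ev next inv pot c) (key : List ℕ) (Q S G Y : Set V) (l n : ℕ) :
    ∀ fuel i, i + fuel = n → Runs
      (iter (muRound 𝒢 ev key Q S G Y l) fuel i ((levelStep 𝒢 next Q S G Y)^[i] ∅))
      ((levelStep 𝒢 next Q S G Y)^[n] ∅) (muInv 𝒢 next inv key Q S G Y l)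
      (fun t => ∑ j ∈ Finset.range n, pot (key ++ [l, j]) t) (cone (key ++ [l]))
      (fuel * (7 + c)) := by
  set f := levelStep 𝒢 next Q S G Y with hf
  intro fuel
  induction fuel with
  | zero =>
    rintro i rfl s hs
    exact ⟨rfl, hs, fun _ _ => rfl, by simp [iter, ret]⟩
  | succ fuel ih =>
    intro i hi s hs
    obtain ⟨h1, h2, h3, h4⟩ := h.runs (key ++ [l, i]) (enlarge 𝒢 Q S G Y (f^[i] ∅))
      ⟨s.steps + 6, s.table⟩ (hs i)
    rw [← muRound_apply (𝒢 := 𝒢) (ev := ev)] at h1 h2 h3 h4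
    set s₁ := (muRound 𝒢 ev key Q S G Y l i (f^[i] ∅) s).2 with hs₁
    have hX : (muRound 𝒢 ev key Q S G Y l i (f^[i] ∅) s).1 = f^[i + 1] ∅ := by
      rw [h1, Function.iterate_succ_apply']
      rfl
    have hagree : ∀ j, j ≠ i → ∀ κ ∈ cone (key ++ [l, j]), s.table κ = s₁.table κ :=
      fun j hj κ hκ => (h3 κ fun hκ' => hj (by
        simpa using eq_of_mem_cone_append (by simp) hκ hκ')).symm
    have hinv : muInv 𝒢 next inv key Q S G Y l s₁.table := by
      intro j
      by_cases hj : j = i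
      · exact hj ▸ h2
      · exact (h.inv_dep _ _ _ _ (hagree j hj)) ▸ hs j
    have hframe : ∀ κ ∉ cone (key ++ [l]), s₁.table κ = s.table κ := fun κ hκ =>
      h3 κ fun hκ' => hκ (cone_append_subset (key ++ [l]) [i] (by simpa using hκ'))
    have hsum := sum_range_add_eq (n := n) (i := i) (by omega)
      (f := fun j => pot (key ++ [l, j]) s₁.table) (g := fun j => pot (key ++ [l, j]) s.table)
      fun j hj => (h.pot_dep _ _ _ (hagree j hj)).symm
    rw [iter_succ, hX, ← hs₁]
    split_ifs with hc
    · refine ⟨?_, hinv, hframe, ?_⟩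
      -- After an early stop the remaining iterates would all be equal, so the result is still the
      -- `n`-th one.
      · have hfix : Function.IsFixedPt f (f^[i] ∅) := by
          rw [Function.iterate_succ_apply'] at hc
          exact hc
        have := hfix.iterate (n - i)
        rw [Function.IsFixedPt, ← Function.iterate_add_apply, Nat.sub_add_cancel (by omega)] at this
        exact this.symm
      · simp only [add_mul, one_mul]
        simp only at h4 hsum ⊢
        omega
    · obtain ⟨g1, g2, g3, g4⟩ := ih (i + 1) (by omega) ⟨s₁.steps + 1, s₁.table⟩ hinv
      refine ⟨g1, g2, fun κ hκ => (g3 κ hκ).trans (hframe κ hκ), ?_⟩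
      simp only [add_mul, one_mul] at g4 ⊢
      simp only at h4 hsum g4 ⊢
      omega

theorem mapIdx_ofFn_eq {α β : Type*} {m : ℕ} (g : Fin m → α) (f : ℕ → α → β) :
    (List.ofFn g).mapIdx f = (List.finRange m).map fun l : Fin m => f l (g l) := by
  apply List.ext_getElem <;> simp

variable {m : ℕ}

/-- The table is ready for an evaluation of the body of the iteration for a `ν`-variable. -/
def bodyInv (𝒢 : LiveGame V) (next : Set V → Set V) (inv : List ℕ → Set V → Table V → Prop)
    (goal : Fin m → Set V) (key : List ℕ) (Q S Y : Set V) (t : Table V) : Prop :=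
  ∀ l, muInv 𝒢 next inv key Q S (goal l) Y l t

/-- The potential of the levels below. -/
def bodyPot (V : Type*) [Fintype V] (m : ℕ) (pot : List ℕ → Table V → ℕ) (key : List ℕ)
    (t : Table V) : ℕ :=
  ((List.finRange m).map fun l : Fin m =>
    ∑ j ∈ Finset.range (Fintype.card V), pot (key ++ [(l : ℕ), j]) t).sum

/-- The keys that the levels below use. -/
def bodyRegion (key : List ℕ) : Set (List ℕ) := {κ | ∃ l, κ ∈ cone (key ++ [l])}

variable [Fintype V]

theorem runs_body (h : Evaluates ev next inv pot c) (goal : Fin m → Set V) (key : List ℕ)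
    (Q S Y : Set V) : Runs
      (interAll ((List.ofFn goal).mapIdx fun l G =>
        iter (muRound 𝒢 ev key Q S G Y l) (Fintype.card V) 0 ∅))
      (levelBody 𝒢 next goal Q S Y) (bodyInv 𝒢 next inv goal key Q S Y)
      (bodyPot V m pot key) (bodyRegion key) (m * (Fintype.card V * (7 + c) + 1)) := by
  rw [interAll_eq, mapIdx_ofFn_eq]
  have hval : levelBody 𝒢 next goal Q S Y = ((List.finRange m).map fun l : Fin m =>
      (levelStep 𝒢 next Q S (goal l) Y)^[Fintype.card V] ∅).foldr (· ∩ ·) Set.univ := by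
    rw [foldr_inter_eq]
    simp only [List.mem_finRange, Set.iInter_true, levelBody]
    exact Set.iInter_congr fun l => mu_eq_iterate (monotone_levelStep h.mono _ _ _ _)
  rw [hval]
  have hr := runs_foldAll (· ∩ ·) Set.univ (List.nodup_finRange m)
    (fun (l : Fin m) _ => iter_mu (𝒢 := 𝒢) h key Q S (goal l) Y l (Fintype.card V) _ 0
      (Nat.zero_add _))
    (fun l _ t t' ht => by
      simp only [muInv]
      exact forall_congr fun j => h.inv_dep _ _ _ _ fun κ hκ =>
        ht κ (cone_append_subset (key ++ [(l : ℕ)]) [j] (by simpa using hκ)))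
    (fun l _ t t' ht => Finset.sum_congr rfl fun j _ => h.pot_dep _ _ _ fun κ hκ =>
      ht κ (cone_append_subset (key ++ [(l : ℕ)]) [j] (by simpa using hκ)))
    (fun l l' κ hκ hκ' => Fin.ext (by simpa using eq_of_mem_cone_append (by simp) hκ hκ'))
  intro s hs
  obtain ⟨h1, h2, h3, h4⟩ := hr s fun l _ => hs l
  refine ⟨h1, fun l => h2 l (List.mem_finRange l), fun κ hκ => h3 κ ?_, ?_⟩
  · rintro ⟨l, -, hl⟩
    exact hκ ⟨l, hl⟩
  · rwa [List.length_finRange] at h4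

end Level

/-! ### Warm-started iterations for `ν`-variables and their amortized cost. -/

section Level

variable {V : Type*} {𝒢 : LiveGame V} {ev : List ℕ → Set V → Sym V (Set V)}
  {next : Set V → Set V} {inv : List ℕ → Set V → Table V → Prop} {pot : List ℕ → Table V → ℕ}
  {c : ℕ} {m : ℕ}

theorem bodyInv_anti (h : Evaluates ev next inv pot c) {goal : Fin m → Set V} {key : List ℕ}
    {Q S S' Y Y' : Set V} {t : Table V} (hS : S' ⊆ S) (hY : Y' ⊆ Y)
    (ht : bodyInv 𝒢 next inv goal key Q S Y t) : bodyInv 𝒢 next inv goal key Q S' Y' t :=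
  fun l => muInv_anti h hS hY (ht l)

theorem mem_bodyRegion {key : List ℕ} {l j : ℕ} {κ : List ℕ} (h : κ ∈ cone (key ++ [l, j])) :
    κ ∈ bodyRegion key :=
  ⟨l, cone_append_subset (key ++ [l]) [j] (by simpa using h)⟩

theorem bodyInv_dep (h : Evaluates ev next inv pot c) (goal : Fin m → Set V) (key : List ℕ)
    (Q S Y : Set V) : DependsOn (bodyInv 𝒢 next inv goal key Q S Y) (bodyRegion key) :=
  fun t t' ht => forall_congr fun _ => forall_congr fun _ =>
    h.inv_dep _ _ t t' fun κ hκ => ht κ (mem_bodyRegion hκ)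

variable [Fintype V]

theorem bodyPot_dep (h : Evaluates ev next inv pot c) (key : List ℕ) :
    DependsOn (bodyPot V m pot key) (bodyRegion key) :=
  fun t t' ht => sum_map_congr fun _ _ => Finset.sum_congr rfl fun _ _ =>
    h.pot_dep _ t t' fun κ hκ => ht κ (mem_bodyRegion hκ)

theorem bodyRegion_subset (key : List ℕ) : bodyRegion key ⊆ cone key :=
  fun _ ⟨l, hl⟩ => cone_append_subset key [l] hl

theorem notMem_bodyRegion (key : List ℕ) : key ∉ bodyRegion key :=
  fun ⟨_, hl⟩ => notMem_cone_append (by simp) hl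

/-- Starting from a pre-fixed point above the greatest fixed point, every round but the last removes
a vertex. There are thus at most `Y.ncard - (levelFix 𝒢 next goal Q S).ncard + 1` rounds; the
inequality expresses this without subtraction. -/
theorem iter_nu (h : Evaluates ev next inv pot c) (goal : Fin m → Set V) (key : List ℕ)
    (Q S : Set V) {body : Set V → Sym V (Set V)} {w : ℕ}
    (hbody : ∀ Y, Runs (body Y) (levelBody 𝒢 next goal Q S Y) (bodyInv 𝒢 next inv goal key Q S Y)
      (bodyPot V m pot key) (bodyRegion key) w) :
    ∀ fuel i (Y : Set V) (s : SymState V), Y.ncard ≤ fuel → levelFix 𝒢 next goal Q S ⊆ Y →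
      levelBody 𝒢 next goal Q S Y ⊆ Y → bodyInv 𝒢 next inv goal key Q S Y s.table →
      let r := iter (fun _ Y => body Y) fuel i Y s
      r.1 = levelFix 𝒢 next goal Q S ∧
        bodyInv 𝒢 next inv goal key Q S (levelFix 𝒢 next goal Q S) r.2.table ∧
        (∀ κ ∉ bodyRegion key, r.2.table κ = s.table κ) ∧
        r.2.steps + bodyPot V m pot key r.2.table + (levelFix 𝒢 next goal Q S).ncard * (w + 1) ≤
          s.steps + bodyPot V m pot key s.table + (Y.ncard + 1) * (w + 1) := by
  have hm := monotone_levelBody (𝒢 := 𝒢) h.mono goal Q S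
  intro fuel
  induction fuel with
  | zero =>
    intro i Y s hY hfix hYle hs
    have hY0 : Y = ∅ := (Set.ncard_eq_zero (Set.toFinite Y)).mp (by omega)
    have hfix0 : levelFix 𝒢 next goal Q S = Y := by
      rw [hY0] at hfix ⊢
      exact Set.subset_empty_iff.mp hfix
    rw [hfix0]
    refine ⟨rfl, hs, fun _ _ => rfl, ?_⟩
    simp only [iter, ret, add_mul]
    omega
  | succ fuel ih =>
    intro i Y s hY hfix hYle hs
    obtain ⟨h1, h2, h3, h4⟩ := hbody Y s hs
    simp only [iter_succ, h1]
    set s₁ := (body Y s).2 with hs₁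
    split_ifs with hc
    · have hfixY : levelFix 𝒢 next goal Q S = Y := hfix.antisymm (subset_nu hc.superset)
      rw [hfixY]
      refine ⟨rfl, h2, h3, ?_⟩
      simp only [add_mul, mul_add]
      omega
    · have hlt : (levelBody 𝒢 next goal Q S Y).ncard < Y.ncard :=
        Set.ncard_lt_ncard (lt_of_le_of_ne hYle hc) (Set.toFinite _)
      have hfix' : levelFix 𝒢 next goal Q S ⊆ levelBody 𝒢 next goal Q S Y := by
        rw [levelFix, ← map_nu hm]
        exact hm hfix
      obtain ⟨g1, g2, g3, g4⟩ := ih (i + 1) (levelBody 𝒢 next goal Q S Y)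
        ⟨s₁.steps + 1, s₁.table⟩ (by omega) hfix' (hm hYle) (bodyInv_anti h subset_rfl hYle h2)
      refine ⟨g1, g2, fun κ hκ => (g3 κ hκ).trans (h3 κ hκ), ?_⟩
      have hmul := Nat.mul_le_mul_right (w + 1) hlt
      simp only [Nat.succ_eq_add_one, add_mul, mul_add] at hmul g4 ⊢
      omega

/-- The table entry of a level together with the entries below it is ready for an evaluation with an
input below `S`. -/
def levelInv (𝒢 : LiveGame V) (next : Set V → Set V) (inv : List ℕ → Set V → Table V → Prop)
    (goal : Fin m → Set V) (Q : Set V) (key : List ℕ) (S : Set V) (t : Table V) : Prop :=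
  ∃ T Y, S ⊆ T ∧ (t key = none ∧ T = Set.univ ∧ Y = Set.univ ∨
    t key = some (T, Y) ∧ Y = levelFix 𝒢 next goal Q T) ∧ bodyInv 𝒢 next inv goal key Q T Y t

/-- A bound for the number of rounds of the iteration for a `ν`-variable still to come. -/
noncomputable def roundsLeft (V : Type*) [Fintype V] (e : Option (Set V × Set V)) : ℕ :=
  match e with
  | none => 2 * Fintype.card V + 1
  | some (T, Y) => T.ncard + Y.ncard

/-- The potential of a level together with the levels below it. -/
noncomputable def levelPot (V : Type*) [Fintype V] (m : ℕ) (pot : List ℕ → Table V → ℕ) (w : ℕ)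
    (key : List ℕ) (t : Table V) : ℕ :=
  roundsLeft V (t key) * (w + 1) + bodyPot V m pot key t

theorem ncard_le_card (S : Set V) : S.ncard ≤ Fintype.card V := by
  rw [← Nat.card_eq_fintype_card, ← Set.ncard_univ]
  exact Set.ncard_le_ncard (Set.subset_univ _)

/-- The stored pair `(T, Y)` has potential `|T| + |Y|` in rounds. Rounds that remove a vertex are
paid for by `|Y|`, and the last, unsuccessful round by the strict decrease of `|T|`. An unchanged
input costs only the comparison, which is the cost `1`. -/
theorem runs_warmNu (h : Evaluates ev next inv pot c) (goal : Fin m → Set V) (key : List ℕ)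
    (Q S : Set V) {body : Set V → Sym V (Set V)} {w : ℕ}
    (hbody : ∀ Y, Runs (body Y) (levelBody 𝒢 next goal Q S Y) (bodyInv 𝒢 next inv goal key Q S Y)
      (bodyPot V m pot key) (bodyRegion key) w) :
    Runs (warmNu (Fintype.card V) key S body) (levelFix 𝒢 next goal Q S)
      (levelInv 𝒢 next inv goal Q key S) (levelPot V m pot w key) (cone key) 1 := by
  classical
  rintro s ⟨T, Y, hST, hTY, hs⟩
  have hYle : levelBody 𝒢 next goal Q T Y ⊆ Y := by
    rcases hTY with ⟨-, -, rfl⟩ | ⟨-, rfl⟩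
    · exact Set.subset_univ _
    · rw [levelFix, map_nu (monotone_levelBody h.mono goal Q T)]
  have hfix : levelFix 𝒢 next goal Q S ⊆ Y := by
    rcases hTY with ⟨-, -, rfl⟩ | ⟨-, rfl⟩
    · exact Set.subset_univ _
    · exact monotone_levelFix h.mono goal Q hST
  set F := levelFix 𝒢 next goal Q S with hF
  -- the effect of iterating from `Y` and storing the result
  have key_run (s₀ : SymState V) (h0 : s₀.table = s.table) :
      let r := iter (fun _ Y => body Y) (Fintype.card V) 0 Y s₀
      let s' : SymState V := ⟨r.2.steps, Function.update r.2.table key (some (S, r.1))⟩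
      r.1 = F ∧ levelInv 𝒢 next inv goal Q key S s'.table ∧
        (∀ κ ∉ cone key, s'.table κ = s.table κ) ∧
        s'.steps + bodyPot V m pot key s'.table + F.ncard * (w + 1) ≤
          s₀.steps + bodyPot V m pot key s.table + (Y.ncard + 1) * (w + 1) ∧
        s'.table key = some (S, F) := by
    obtain ⟨g1, g2, g3, g4⟩ := iter_nu (𝒢 := 𝒢) h goal key Q S hbody (Fintype.card V) 0 Y s₀
      (ncard_le_card Y) hfix ((levelBody_mono h.mono goal Q hST subset_rfl).trans hYle)
      (h0 ▸ bodyInv_anti h hST subset_rfl hs)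
    set r := iter (fun _ Y => body Y) (Fintype.card V) 0 Y s₀ with hr
    have hagree : ∀ κ ∈ bodyRegion key,
        r.2.table κ = Function.update r.2.table key (some (S, r.1)) κ := fun κ hκ =>
      (Function.update_of_ne (fun e : κ = key => notMem_bodyRegion key (e ▸ hκ)) _ _).symm
    refine ⟨g1, ⟨S, F, subset_rfl, Or.inr ⟨?_, rfl⟩, ?_⟩, fun κ hκ => ?_, ?_, ?_⟩
    · simp [g1, hF]
    · rw [← bodyInv_dep h goal key Q S F _ _ hagree]
      exact g2
    · have hne : κ ≠ key := fun h => hκ (h ▸ List.prefix_refl _)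
      rw [← h0]
      exact (Function.update_of_ne hne _ _).trans
        (g3 κ fun h => hκ (bodyRegion_subset key h))
    · rw [← h0]
      simp only [← bodyPot_dep (V := V) (m := m) h key _ _ hagree]
      exact g4
    · simp [g1, hF]
  have hrounds (a b : ℕ) (hab : a + 1 ≤ b) : a * (w + 1) + (w + 1) ≤ b * (w + 1) := by
    have := Nat.mul_le_mul_right (w + 1) hab
    rwa [add_mul, one_mul] at this
  rcases hTY with ⟨hnone, rfl, rfl⟩ | ⟨hsome, hYfix⟩
  · obtain ⟨g1, g2, g3, g4, g5⟩ := key_run s rfl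
    set r := iter (fun _ Y => body Y) (Fintype.card V) 0 Set.univ s with hr
    have heq : warmNu (Fintype.card V) key S body s =
        (r.1, ⟨r.2.steps, Function.update r.2.table key (some (S, r.1))⟩) := by
      rw [warmNu, bind_fetch hnone]
      rfl
    rw [heq]
    refine ⟨g1, g2, g3, ?_⟩
    simp only [levelPot, hnone, roundsLeft] at g4 g5 ⊢
    rw [g5]
    -- In a first evaluation, `n + 1` rounds and the potential `|S| ≤ n` of the new entry fit into
    -- `2n + 1`.
    have := hrounds (S.ncard + Set.univ.ncard) (2 * Fintype.card V + 1) (by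
      have := ncard_le_card S
      have := ncard_le_card (Set.univ : Set V)
      omega)
    simp only [add_mul, mul_add] at g4 this ⊢
    omega
  · by_cases hc : S = T
    · subst hc
      have heq : warmNu (Fintype.card V) key S body s = (Y, ⟨s.steps + 1, s.table⟩) := by
        rw [warmNu, bind_fetch hsome]
        exact bind_sEq_pos rfl _ _
      rw [heq]
      exact ⟨hYfix, ⟨S, Y, subset_rfl, Or.inr ⟨hsome, hYfix⟩, hs⟩, fun _ _ => rfl, by
        simp only
        omega⟩
    · obtain ⟨g1, g2, g3, g4, g5⟩ := key_run ⟨s.steps + 1, s.table⟩ rfl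
      set r := iter (fun _ Y => body Y) (Fintype.card V) 0 Y ⟨s.steps + 1, s.table⟩ with hr
      have heq : warmNu (Fintype.card V) key S body s =
          (r.1, ⟨r.2.steps, Function.update r.2.table key (some (S, r.1))⟩) := by
        rw [warmNu, bind_fetch hsome]
        exact bind_sEq_neg hc _ _
      rw [heq]
      refine ⟨g1, g2, g3, ?_⟩
      simp only [levelPot, hsome, roundsLeft] at g4 g5 ⊢
      rw [g5]
      have := hrounds (S.ncard + Y.ncard) (T.ncard + Y.ncard) (by
        have := Set.ncard_lt_ncard (lt_of_le_of_ne hST hc) (Set.toFinite _)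
        omega)
      simp only [add_mul, mul_add] at g4 this ⊢
      omega

/-- The number of steps of one round of the iteration for a `ν`-variable, without the final test and
without the steps that are paid for by the levels below. -/
def roundCost (V : Type*) [Fintype V] (m c : ℕ) : ℕ := m * (Fintype.card V * (7 + c) + 1)

/-- The three unpaid steps are the complement, the intersection and the comparison with the stored
input. -/
theorem evaluates_evalLevel {nextEv : List ℕ → Set V → Set V → Sym V (Set V)} (bad Q : Set V)
    (h : Evaluates (fun key S => nextEv key (Q ∩ badᶜ) S) next inv pot c) (goal : Fin m → Set V) :
    Evaluates
      (fun key S => evalLevel 𝒢 (Fintype.card V) nextEv key (List.ofFn goal) bad Q S)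
      (levelFix 𝒢 next goal (Q ∩ badᶜ)) (levelInv 𝒢 next inv goal (Q ∩ badᶜ))
      (levelPot V m pot (roundCost V m c)) 3 where
  mono := monotone_levelFix h.mono _ _
  inv_anti := fun hST ⟨T, Y, hT, ht⟩ => ⟨T, Y, hST.trans hT, ht⟩
  inv_dep := fun key S t t' ht => by
    have h1 := ht key (List.prefix_refl key)
    have h2 (T Y) := bodyInv_dep (𝒢 := 𝒢) h goal key (Q ∩ badᶜ) T Y t t' fun κ hκ =>
      ht κ (bodyRegion_subset key hκ)
    simp only [levelInv, h1, h2]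
  pot_dep := fun key t t' ht => by
    have h1 := ht key (List.prefix_refl key)
    have h2 := bodyPot_dep (V := V) (m := m) h key t t' fun κ hκ =>
      ht κ (bodyRegion_subset key hκ)
    simp only [levelPot, h1, h2]
  runs := fun key S s hs => by
    obtain ⟨h1, h2, h3, h4⟩ := runs_warmNu h goal key (Q ∩ badᶜ) S
      (fun Y => runs_body (𝒢 := 𝒢) h goal key (Q ∩ badᶜ) S Y) ⟨s.steps + 2, s.table⟩ hs
    refine ⟨h1, h2, h3, ?_⟩
    refine Nat.le_trans h4 ?_
    simp only [roundCost]
    omega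

end Level

/-! ### All levels together, and the potential of the empty table. -/

section Below

variable {V : Type*} {k : ℕ} (𝒢 : LiveGame V) (𝓡 : GenRabin V k)

/-- The table is ready for an evaluation of the levels still to come with an input below `S`. -/
def belowInv : ℕ → List (Fin k) → Set V → List ℕ → Set V → Table V → Prop
  | 0, _, _, _, _, _ => True
  | d + 1, P, Q, key, S, t => ∀ p ∈ P,
      levelInv 𝒢 (below 𝒢 𝓡 d (P.erase p).toFinset (Q ∩ (𝓡.R p)ᶜ))
        (belowInv d (P.erase p) (Q ∩ (𝓡.R p)ᶜ)) (𝓡.G p) (Q ∩ (𝓡.R p)ᶜ)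
        (key ++ [(p : ℕ) + 1]) S t

variable [Fintype V]

/-- The potential of the levels still to come. -/
noncomputable def belowPot : ℕ → List (Fin k) → List ℕ → Table V → ℕ
  | 0, _, _, _ => 0
  | d + 1, P, key, t => (P.map fun p => levelPot V (𝓡.m p) (belowPot d (P.erase p))
      (roundCost V (𝓡.m p) (4 * d)) (key ++ [(p : ℕ) + 1]) t).sum

variable {𝒢 𝓡}

omit [Fintype V] in
theorem toFinset_erase {P : List (Fin k)} (hP : P.Nodup) (p : Fin k) :
    (P.erase p).toFinset = P.toFinset.erase p := by
  ext q
  simp [hP.mem_erase_iff]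

/-- Each of the `d` available pairs costs the three unpaid steps of its level and one union;
everything else is paid for by the potential. -/
theorem evaluates_evalBelow {d : ℕ} {P : List (Fin k)} (hP : P.Nodup) (hd : P.length = d)
    (Q : Set V) : Evaluates (fun key S => evalBelow 𝒢 𝓡 (Fintype.card V) d P key Q S)
      (below 𝒢 𝓡 d P.toFinset Q) (belowInv 𝒢 𝓡 d P Q) (belowPot 𝓡 d P) (4 * d) := by
  induction d generalizing P Q with
  | zero =>
    exact ⟨fun _ _ h => h, fun _ _ => trivial, fun _ _ _ _ _ => rfl, fun _ _ _ _ => rfl,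
      fun _ _ s _ => ⟨rfl, trivial, fun _ _ => rfl, le_rfl⟩⟩
  | succ d ih =>
    have hlev (p : Fin k) (hp : p ∈ P) := evaluates_evalLevel (𝒢 := 𝒢) (𝓡.R p) Q
      (ih (hP.erase p) (by rw [List.length_erase_of_mem hp, hd, Nat.add_sub_cancel])
        (Q ∩ (𝓡.R p)ᶜ)) (𝓡.G p)
    have hcone (p : Fin k) (key : List ℕ) : cone (key ++ [(p : ℕ) + 1]) ⊆ cone key :=
      cone_append_subset _ _
    refine ⟨monotone_below 𝒢 𝓡 _ _ Q, fun hST ht p hp => (hlev p hp).inv_anti hST (ht p hp),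
      fun key S t t' ht => ?_, fun key t t' ht => ?_, fun key S s hs => ?_⟩
    · exact forall_congr fun p => forall_congr fun hp => (hlev p hp).inv_dep _ _ t t'
        fun κ hκ => ht κ (hcone p key hκ)
    · exact sum_map_congr fun p hp => (hlev p hp).pot_dep _ t t'
        fun κ hκ => ht κ (hcone p key hκ)
    · have heq : evalBelow 𝒢 𝓡 (Fintype.card V) (d + 1) P key Q S = foldAll (· ∪ ·) ∅
          (P.map fun p => evalLevel 𝒢 (Fintype.card V)
            (evalBelow 𝒢 𝓡 (Fintype.card V) d (P.erase p)) (key ++ [(p : ℕ) + 1])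
            (List.ofFn (𝓡.G p)) (𝓡.R p) Q S) := by
        rw [← unionAll_eq]
        rfl
      have hval : below 𝒢 𝓡 (d + 1) P.toFinset Q S = (P.map fun p =>
          levelFix 𝒢 (below 𝒢 𝓡 d (P.erase p).toFinset (Q ∩ (𝓡.R p)ᶜ)) (𝓡.G p)
            (Q ∩ (𝓡.R p)ᶜ) S).foldr (· ∪ ·) ∅ := by
        rw [foldr_union_eq]
        simp only [below, List.mem_toFinset, toFinset_erase hP]
      simp only [heq, hval]
      obtain ⟨h1, h2, h3, h4⟩ := runs_foldAll (· ∪ ·) ∅ hP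
        (fun p hp => (hlev p hp).runs (key ++ [(p : ℕ) + 1]) S)
        (fun p hp => (hlev p hp).inv_dep _ _) (fun p hp => (hlev p hp).pot_dep _)
        (fun p p' κ hκ hκ' => Fin.ext (by
          have := eq_of_mem_cone_append (by simp) hκ hκ'
          simpa using this)) s hs
      refine ⟨h1, h2, fun κ hκ => h3 κ fun ⟨p, _, hp⟩ => hκ (hcone p key hp), ?_⟩
      rw [show 4 * (d + 1) = P.length * (3 + 1) by rw [hd]; ring]
      exact h4

omit [Fintype V] in
variable (𝒢) in
theorem belowInv_empty (d : ℕ) (P : List (Fin k)) (Q : Set V) (key : List ℕ) (S : Set V) :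
    belowInv 𝒢 𝓡 d P Q key S fun _ => none := by
  induction d generalizing P Q key S with
  | zero => trivial
  | succ d ih =>
    exact fun p _ => ⟨Set.univ, Set.univ, Set.subset_univ _, Or.inl ⟨rfl, rfl, rfl⟩,
      fun _ _ => ih _ _ _ _⟩

/-- The coefficient in the bound for the initial potential. -/
def potCoeff : ℕ → ℕ
  | 0 => 0
  | d + 1 => (d + 1) * (27 * (d + 1) + potCoeff d)

theorem potCoeff_add_le (d : ℕ) : potCoeff d + 27 * (d + 1) + 3 ≤ 189 * d.factorial := by
  -- The stronger additive term makes the induction close. Equality at `d = 0`, namely `27 + 162`,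
  -- is the origin of `189`.
  have key (d : ℕ) : potCoeff (d + 1) + 54 * (d + 3) ≤ 189 * (d + 1).factorial := by
    induction d with
    | zero => simp [potCoeff]
    | succ d ih =>
      rw [potCoeff, Nat.factorial_succ]
      have := Nat.mul_le_mul_left (d + 2) ih
      nlinarith
  cases d with
  | zero => simp [potCoeff]
  | succ d =>
    have := key d
    omega

variable [Nonempty V]

/-- The factor `27` comes from `2n + 1 ≤ 3n` rounds of cost at most `9(d + 1)mn`. The inner
potential is counted for `m` goals and `n` counters, which supplies one more factor `n` and the
factor `m`. -/
theorem levelPot_empty_le {pot : List ℕ → Table V → ℕ} {m d M : ℕ} (hm : 1 ≤ m) (hM : 1 ≤ M)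
    (h : ∀ key, pot key (fun _ => none) ≤ potCoeff d * (Fintype.card V ^ (d + 1) * M))
    (key : List ℕ) : levelPot V m pot (roundCost V m (4 * d)) key (fun _ => none) ≤
      (27 * (d + 1) + potCoeff d) * (Fintype.card V ^ (d + 2) * (m * M)) := by
  have hn : 1 ≤ Fintype.card V := Fintype.card_pos
  have hbody : bodyPot V m pot key (fun _ => none) ≤
      m * (Fintype.card V * (potCoeff d * (Fintype.card V ^ (d + 1) * M))) := by
    have h1 : ∀ x ∈ (List.finRange m).map fun l : Fin m =>
        ∑ j ∈ Finset.range (Fintype.card V), pot (key ++ [(l : ℕ), j]) (fun _ => none),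
        x ≤ Fintype.card V * (potCoeff d * (Fintype.card V ^ (d + 1) * M)) := by
      intro x hx
      obtain ⟨l, -, rfl⟩ := List.mem_map.mp hx
      refine (Finset.sum_le_card_nsmul _ _ _ fun j _ => h _).trans ?_
      simp
    refine (List.sum_le_card_nsmul _ _ h1).trans ?_
    simp
  simp only [levelPot, roundsLeft, roundCost]
  refine (Nat.add_le_add_left hbody _).trans ?_
  generalize Fintype.card V = n at *
  have h1 : m * (n * (7 + 4 * d) + 1) + 1 ≤ m * n * (9 * (d + 1)) := by
    have h2 : 1 ≤ m * n := Nat.mul_pos hm hn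
    have h3 : m ≤ m * n := Nat.le_mul_of_pos_right m hn
    nlinarith [Nat.zero_le (m * n * d)]
  have h4 : (2 * n + 1) * (m * (n * (7 + 4 * d) + 1) + 1) ≤ 3 * n * (m * n * (9 * (d + 1))) :=
    Nat.mul_le_mul (by omega) h1
  have h5 : n ^ 2 * m ≤ n ^ (d + 2) * (m * M) :=
    Nat.mul_le_mul (Nat.pow_le_pow_right hn (by omega)) (Nat.le_mul_of_pos_right m hM)
  have h6 := Nat.mul_le_mul_left (27 * (d + 1)) h5
  calc _ ≤ 3 * n * (m * n * (9 * (d + 1))) + m * (n * (potCoeff d * (n ^ (d + 1) * M))) :=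
        Nat.add_le_add_right h4 _
    _ = 27 * (d + 1) * (n ^ 2 * m) + potCoeff d * (n ^ (d + 2) * (m * M)) := by ring
    _ ≤ _ := by rw [add_mul]; exact Nat.add_le_add_right h6 _

theorem belowPot_empty_le (hm : ∀ j, 1 ≤ 𝓡.m j) {d : ℕ} {P : List (Fin k)} (hd : P.length = d)
    (key : List ℕ) : belowPot 𝓡 d P key (fun _ => none : Table V) ≤
      potCoeff d * (Fintype.card V ^ (d + 1) * (P.map 𝓡.m).prod) := by
  induction d generalizing P key with
  | zero => simp [belowPot]
  | succ d ih =>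
    have h : ∀ x ∈ P.map fun p => levelPot V (𝓡.m p) (belowPot 𝓡 d (P.erase p))
        (roundCost V (𝓡.m p) (4 * d)) (key ++ [(p : ℕ) + 1]) (fun _ => none),
        x ≤ (27 * (d + 1) + potCoeff d) *
          (Fintype.card V ^ (d + 2) * (P.map 𝓡.m).prod) := by
      intro x hx
      obtain ⟨p, hp, rfl⟩ := List.mem_map.mp hx
      -- Whichever pair comes first, its factor `m` completes the same product; the `d + 1` choices
      -- produce the factorial in `potCoeff`.
      rw [← ((List.perm_cons_erase hp).map 𝓡.m).prod_eq.symm, List.map_cons, List.prod_cons]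
      refine levelPot_empty_le (hm p) (List.one_le_prod_of_one_le fun x hx => ?_)
        (fun key => ih ?_ key) _
      · obtain ⟨q, -, rfl⟩ := List.mem_map.mp hx
        exact hm q
      · rw [List.length_erase_of_mem hp, hd, Nat.add_sub_cancel]
    refine (List.sum_le_card_nsmul _ _ h).trans (le_of_eq ?_)
    rw [List.length_map, hd, smul_eq_mul, potCoeff, mul_assoc]

end Below

end Sym

/-! ### Correctness and step bound of the fixpoint algorithm. -/

section Algorithm

variable {V : Type*} [Fintype V] {k : ℕ} (𝒢 : LiveGame V) (𝓡 : GenRabin V k)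

theorem fixpointAlgorithm_spec : (fixpointAlgorithm 𝒢 𝓡).1 = fixpoint 𝒢 𝓡 ∧
    (fixpointAlgorithm 𝒢 𝓡).2 ≤ Sym.levelPot V 1 (Sym.belowPot 𝓡 k (List.finRange k))
      (Sym.roundCost V 1 (4 * k)) [0] (fun _ => none) + 3 := by
  have h := Sym.evaluates_evalLevel (𝒢 := 𝒢) ∅ Set.univ
    (Sym.evaluates_evalBelow (𝒢 := 𝒢) (𝓡 := 𝓡) (List.nodup_finRange k) List.length_finRange
      (Set.univ ∩ ∅ᶜ)) fun _ : Fin 1 => ∅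
  obtain ⟨h1, -, -, h4⟩ := h.runs [0] ∅ ⟨0, fun _ => none⟩
    ⟨Set.univ, Set.univ, Set.subset_univ _, Or.inl ⟨rfl, rfl, rfl⟩,
      fun _ _ => Sym.belowInv_empty 𝒢 _ _ _ _ _⟩
  have hgoal : List.ofFn (fun _ : Fin 1 => (∅ : Set V)) = [∅] := rfl
  rw [hgoal] at h1 h4
  refine ⟨h1.trans ?_, (Nat.le_add_right _ _).trans (h4.trans ?_)⟩
  · rw [fixpoint_eq_levelFix, List.toFinset_finRange, Set.compl_empty, Set.univ_inter]
  · simp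

theorem fixpointAlgorithm_steps_le [Nonempty V] (hm : ∀ j, 1 ≤ 𝓡.m j) :
    (fixpointAlgorithm 𝒢 𝓡).2 ≤
      189 * (Fintype.card V ^ (k + 2) * k.factorial * ∏ j, 𝓡.m j) := by
  have hM : 1 ≤ ∏ j, 𝓡.m j := Finset.one_le_prod' fun j _ => hm j
  have hpot := Sym.levelPot_empty_le (V := V) (d := k) le_rfl hM (fun key => by
    have := Sym.belowPot_empty_le (V := V) hm (List.length_finRange (n := k)) key
    rwa [← Fin.prod_univ_def] at this) [0]
  refine (fixpointAlgorithm_spec 𝒢 𝓡).2.trans ((Nat.add_le_add_right hpot 3).trans ?_)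
  have hn : 1 ≤ Fintype.card V ^ (k + 2) * ∏ j, 𝓡.m j :=
    Nat.mul_pos (Nat.pow_pos Fintype.card_pos) hM
  have hc := Nat.mul_le_mul_right (Fintype.card V ^ (k + 2) * ∏ j, 𝓡.m j) (Sym.potCoeff_add_le k)
  rw [one_mul]
  nlinarith

end Algorithm

end FairGame

theorem mainTheorem2 :
    ∃ C : ℕ, ∀ (V : Type*) [Fintype V] [Nonempty V] (𝒢 : FairGame.LiveGame V)
      (_ : ∀ v, ∃ w, 𝒢.E v w) (k : ℕ),
      (∀ 𝓡 : FairGame.GenRabin V k, (∀ j, 1 ≤ 𝓡.m j) →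
        FairGame.fixpoint 𝒢 𝓡
            = FairGame.winningRegion 𝒢 (FairGame.fairAdversarial 𝒢 𝓡.plays) ∧
        (FairGame.fixpointAlgorithm 𝒢 𝓡).1 = FairGame.fixpoint 𝒢 𝓡 ∧
        (FairGame.fixpointAlgorithm 𝒢 𝓡).2
            ≤ C * (Fintype.card V ^ (k + 2) * k.factorial * ∏ j, 𝓡.m j) ∧
        ∃ ρ₀ : FairGame.Strategy 𝒢 𝒢.V0, FairGame.FiniteMemory ρ₀ ∧
          ∀ v ∈ FairGame.fixpoint 𝒢 𝓡,
            FairGame.WinsFrom ρ₀ (FairGame.fairAdversarial 𝒢 𝓡.plays) v) ∧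
      (∀ F : Fin k → Finset V, (∀ j, (F j).Nonempty) →
        (FairGame.GenRabin.ofMuller F).plays = FairGame.mullerPlays F ∧
        FairGame.fixpoint 𝒢 (FairGame.GenRabin.ofMuller F)
            = FairGame.winningRegion 𝒢 (FairGame.fairAdversarial 𝒢 (FairGame.mullerPlays F)) ∧
        (FairGame.fixpointAlgorithm 𝒢 (FairGame.GenRabin.ofMuller F)).1
            = FairGame.fixpoint 𝒢 (FairGame.GenRabin.ofMuller F) ∧
        (FairGame.fixpointAlgorithm 𝒢 (FairGame.GenRabin.ofMuller F)).2
            ≤ C * (Fintype.card V ^ (k + 2) * k.factorial * ∏ j, (F j).card) ∧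
        ∃ ρ₀ : FairGame.Strategy 𝒢 𝒢.V0, FairGame.FiniteMemory ρ₀ ∧
          ∀ v ∈ FairGame.fixpoint 𝒢 (FairGame.GenRabin.ofMuller F),
            FairGame.WinsFrom ρ₀
              (FairGame.fairAdversarial 𝒢 (FairGame.mullerPlays F)) v) := by
  refine ⟨189, fun V _ _ 𝒢 hE k => ?_⟩
  have hmain (𝓡 : FairGame.GenRabin V k) (hm : ∀ j, 1 ≤ 𝓡.m j) :=
    And.intro (FairGame.fixpoint_eq_winningRegion (𝓡 := 𝓡) hE hm)
      (And.intro (FairGame.fixpointAlgorithm_spec 𝒢 𝓡).1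
        (And.intro (FairGame.fixpointAlgorithm_steps_le 𝒢 𝓡 hm)
          (FairGame.exists_finiteMemory_winning hE hm)))
  refine ⟨hmain, fun F hF => ⟨FairGame.plays_ofMuller F, ?_⟩⟩
  have h := hmain (FairGame.GenRabin.ofMuller F) fun j => Finset.card_pos.mpr (hF j)
  rw [FairGame.plays_ofMuller] at h
  exact h
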